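/- Let $k$ be a field of characteristic $0$ and let $P=k((x_1))\cdots((x_n))((\partial_1^{-1}))\cdots((\partial_n^{-1}))$ be the ring of formal pseudo-differential operators in $n$ variables, with the multiplication given by the Leibniz rule. For $L\in P$ let $\mathrm{res}_P(L)$ be the coefficient of $L$ at $x_1^{-1}\cdots x_n^{-1}\partial_1^{-1}\cdots\partial_n^{-1}$, and let $L=L_++L_-$, where $L_+$ contains only the powers $\ge 0$ and $L_-$ only the powers $<0$ of $\partial_n$. On $P^n$ put $\langle L,M\rangle=\sum_i\mathrm{res}_P(L_iM_i)$ and $[X,Y]_R=\frac12[RX,Y]+\frac12[X,RY]$ (componentwise), where $RX=X_+-X_-$. Let $\mathcal F(P^n)$ be the space of functions on $P^n$ that are polynomial in any number of coefficients of the operators $L_1,\dots,L_n$: such a function is given by a possibly infinite sum of monomials of bounded degree in these coefficients, of which only finitely many are nonzero at each point. The gradient $\nabla_F(L)\in P^n$ is defined by $\langle M,\nabla_F(L)\rangle=\frac{d}{d\varepsilon}F(L+\varepsilon M)|_{\varepsilon=0}$ for all $M\in P^n$, and $\{F,G\}_R(L)=\langle L,[\nabla_F(L),\nabla_G(L)]_R\rangle$.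 For a multi-index $m=(m_1,\dots,m_n)$ of nonnegative integers let $H_m(L)=\mathrm{res}_P(L_1^{m_1}\cdots L_n^{m_n})$, and let $P'\subset P^n$ be the set of all $L$ with $[L_i,L_j]=0$ for all $i,j$. Then $H_m\in\mathcal F(P^n)$, every $F\in\mathcal F(P^n)$ has a unique gradient at every point of $P^n$, and the Hamiltonian system $$\frac{\partial F}{\partial t_m}=\{F,H_m\}_R,\qquad F\in\mathcal F(P^n),$$ has on $P'$ the form $$\frac{\partial L_i}{\partial t_m}=m_i\,\bigl[(L_1^{m_1}\cdots L_{i-1}^{m_{i-1}}L_i^{m_i-1}L_{i+1}^{m_{i+1}}\cdots L_n^{m_n})_+,\,L_i\bigr],\qquad i=1,\dots,n$$ (where the right-hand side is $0$ if $m_i=0$). That is, for $L\in P'$ and a tangent vector $X=\partial L/\partial t_m\in T_L=P^n$, the derivative of every $F\in\mathcal F(P^n)$ at $L$ along $X$ is $\{F,H_m\}_R(L)$ if and only if $X_i$ is this right-hand side for all $i$. -/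

import Mathlib

noncomputable section

/-- The exponents `(i, j)` of the monomials
`x₁ ^ i₁ ⋯ xₙ ^ iₙ ∂₁ ^ j₁ ⋯ ∂ₙ ^ jₙ`, with integers `iₛ` and `jₛ`. -/
def Exponent (n : ℕ) : Type := (Fin n → ℤ) × (Fin n → ℤ)

namespace Exponent

variable {n : ℕ}

/-- The exponents of `x₁, …, xₙ`. -/
def x (e : Exponent n) : Fin n → ℤ := e.1

/-- The exponents of `∂₁, …, ∂ₙ`. -/
def d (e : Exponent n) : Fin n → ℤ := e.2

instance : AddCommGroup (Exponent n) := inferInstanceAs (AddCommGroup ((Fin n → ℤ) × (Fin n → ℤ)))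

theorem ext {e f : Exponent n} (hx : e.x = f.x) (hd : e.d = f.d) : e = f := Prod.ext hx hd

@[simp] theorem x_add (e f : Exponent n) : (e + f).x = e.x + f.x := rfl
@[simp] theorem d_add (e f : Exponent n) : (e + f).d = e.d + f.d := rfl
@[simp] theorem x_sub (e f : Exponent n) : (e - f).x = e.x - f.x := rfl
@[simp] theorem d_sub (e f : Exponent n) : (e - f).d = e.d - f.d := rfl
@[simp] theorem x_neg (e : Exponent n) : (-e).x = -e.x := rfl
@[simp] theorem d_neg (e : Exponent n) : (-e).d = -e.d := rfl
@[simp] theorem x_zero : (0 : Exponent n).x = 0 := rfl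
@[simp] theorem d_zero : (0 : Exponent n).d = 0 := rfl

/-- The list of exponents with respect to `∂ₙ⁻¹, …, ∂₁⁻¹, xₙ, …, x₁`, in this order, ordered
lexicographically: the exponent of `∂ₙ⁻¹` is the most significant one and the exponent of `x₁` is
the least significant one. -/
def key (e : Exponent n) : Lex ((Fin n)ᵒᵈ → ℤ) ×ₗ Lex ((Fin n)ᵒᵈ → ℤ) :=
  toLex (toLex fun s => -e.d (OrderDual.ofDual s), toLex fun s => e.x (OrderDual.ofDual s))

theorem key_injective : Function.Injective (key (n := n)) := by
  intro e f h
  have h' := toLex.injective h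
  have h1 := toLex.injective (congrArg Prod.fst h')
  have h2 := toLex.injective (congrArg Prod.snd h')
  refine Exponent.ext (funext fun s => ?_) (funext fun s => ?_)
  · exact congrFun h2 (OrderDual.toDual s)
  · exact neg_injective (congrFun h1 (OrderDual.toDual s))

theorem key_add (e f : Exponent n) : key (e + f) = key e + key f := by
  apply ofLex.injective
  refine Prod.ext ?_ rfl
  apply ofLex.injective
  funext s
  exact neg_add _ _

/-- Monomials are compared through `Exponent.key`. -/
instance : LinearOrder (Exponent n) := LinearOrder.lift' key key_injective

theorem le_iff_key {e f : Exponent n} : e ≤ f ↔ key e ≤ key f := Iff.rfl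

instance : IsOrderedCancelAddMonoid (Exponent n) :=
  Function.Injective.isOrderedCancelAddMonoid key key_add Iff.rfl

/-- The exponent of the monomial `x ^ γ ∂ ^ γ`. -/
def diag (γ : Fin n → ℕ) : Exponent n := (fun s => (γ s : ℤ), fun s => (γ s : ℤ))

@[simp] theorem x_diag (γ : Fin n → ℕ) (s : Fin n) : (diag γ).x s = γ s := rfl
@[simp] theorem d_diag (γ : Fin n → ℕ) (s : Fin n) : (diag γ).d s = γ s := rfl

theorem diag_injective : Function.Injective (diag (n := n)) := by
  intro γ δ h
  funext s
  have := congrArg (fun e : Exponent n => e.x s) h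
  simpa using this

theorem diag_add (γ δ : Fin n → ℕ) : diag (γ + δ) = diag γ + diag δ := by
  refine Exponent.ext (funext fun s => ?_) (funext fun s => ?_) <;> simp

theorem neg_diag_monotone : Monotone fun γ : Fin n → ℕ => -diag γ := by
  intro γ δ h
  rcases h.eq_or_lt with rfl | h
  · exact le_rfl
  rw [le_iff_key]
  refine Prod.Lex.toLex_le_toLex.2 (Or.inl ?_)
  refine Pi.toLex_strictMono ?_
  rw [Pi.lt_def] at h ⊢
  obtain ⟨h1, s, h2⟩ := h
  refine ⟨fun t => ?_, OrderDual.toDual s, ?_⟩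
  · have := h1 (OrderDual.ofDual t)
    simpa using this
  · simpa using h2

theorem isPWO_range_neg_diag : (Set.range fun γ : Fin n → ℕ => -diag γ).IsPWO := by
  rw [← Set.image_univ]
  exact (Set.isPWO_of_wellQuasiOrderedLE _).image_of_monotone neg_diag_monotone

end Exponent

open Finset in
/-- The identity behind the associativity of the Leibniz multiplication in one variable. -/
theorem leibniz_assoc_one (b₁ b₂ a₂ a₃ : ℤ) (d : ℕ) :
    ∑ p ∈ antidiagonal d, (Ring.choose b₁ p.1 * (descPochhammer ℤ p.1).eval a₂) *
        (Ring.choose (b₁ + b₂ - p.1) p.2 * (descPochhammer ℤ p.2).eval a₃) =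
      ∑ p ∈ antidiagonal d, (Ring.choose b₂ p.2 * (descPochhammer ℤ p.2).eval a₃) *
        (Ring.choose b₁ p.1 * (descPochhammer ℤ p.1).eval (a₂ + a₃ - p.2)) := by
  have h1 : ∀ p q : ℕ, Ring.choose (b₁ + b₂ - p) q =
      ∑ r ∈ antidiagonal q, Ring.choose (b₁ - p) r.1 * Ring.choose b₂ r.2 := by
    intro p q
    rw [← Ring.add_choose_eq q (Commute.all _ _)]
    congr 1
    ring
  have h2 : ∀ p r : ℕ, Ring.choose b₁ p * Ring.choose (b₁ - p) r =
      ((p + r).choose p : ℤ) * Ring.choose b₁ (p + r) := by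
    intro p r
    have := Ring.choose_smul_choose b₁ (Nat.le_add_right p r)
    rw [Nat.add_sub_cancel_left] at this
    rw [← this, nsmul_eq_mul]
  have h3 : ∀ p q : ℕ, (descPochhammer ℤ p).eval (a₂ + a₃ - q) =
      ∑ r ∈ antidiagonal p, (p.choose r.1 : ℤ) *
        ((descPochhammer ℤ r.1).eval a₂ * (descPochhammer ℤ r.2).eval (a₃ - q)) := by
    intro p q
    have := Ring.descPochhammer_smeval_add p (Commute.all a₂ (a₃ - q))
    simp only [← Polynomial.eval_eq_smeval] at this
    rw [← this]
    congr 1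
    ring
  have h4 : ∀ q r : ℕ, (descPochhammer ℤ q).eval a₃ * (descPochhammer ℤ r).eval (a₃ - q) =
      (descPochhammer ℤ (q + r)).eval a₃ := by
    intro q r
    rw [← descPochhammer_mul]
    simp
  have e1 : ∑ p ∈ antidiagonal d, (Ring.choose b₁ p.1 * (descPochhammer ℤ p.1).eval a₂) *
        (Ring.choose (b₁ + b₂ - p.1) p.2 * (descPochhammer ℤ p.2).eval a₃) =
      ∑ p ∈ antidiagonal d, ∑ r ∈ antidiagonal p.2, ((p.1 + r.1).choose p.1 : ℤ) *
        Ring.choose b₁ (p.1 + r.1) * (descPochhammer ℤ p.1).eval a₂ *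
        (descPochhammer ℤ (r.2 + r.1)).eval a₃ * Ring.choose b₂ r.2 := by
    refine sum_congr rfl fun p _ => ?_
    rw [h1, Finset.sum_mul, Finset.mul_sum]
    refine sum_congr rfl fun r hr => ?_
    rw [← h2, add_comm r.2, HasAntidiagonal.mem_antidiagonal.1 hr]
    ring
  have e2 : ∑ p ∈ antidiagonal d, (Ring.choose b₂ p.2 * (descPochhammer ℤ p.2).eval a₃) *
        (Ring.choose b₁ p.1 * (descPochhammer ℤ p.1).eval (a₂ + a₃ - p.2)) =
      ∑ p ∈ antidiagonal d, ∑ r ∈ antidiagonal p.1, ((r.1 + r.2).choose r.1 : ℤ) *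
        Ring.choose b₁ (r.1 + r.2) * (descPochhammer ℤ r.1).eval a₂ *
        (descPochhammer ℤ (p.2 + r.2)).eval a₃ * Ring.choose b₂ p.2 := by
    refine sum_congr rfl fun p _ => ?_
    rw [h3, Finset.mul_sum, Finset.mul_sum]
    refine sum_congr rfl fun r hr => ?_
    rw [← h4, HasAntidiagonal.mem_antidiagonal.1 hr]
    ring
  rw [e1, e2, Finset.sum_sigma', Finset.sum_sigma']
  refine Finset.sum_bij' (fun x _ => ⟨(x.1.1 + x.2.1, x.2.2), (x.1.1, x.2.1)⟩)
    (fun x _ => ⟨(x.2.1, x.2.2 + x.1.2), (x.2.2, x.1.2)⟩) ?_ ?_ ?_ ?_ ?_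
  · rintro ⟨⟨p, q⟩, ⟨r, s⟩⟩ h
    simp only [mem_sigma, HasAntidiagonal.mem_antidiagonal] at h ⊢
    obtain ⟨h, rfl⟩ := h
    exact ⟨by rw [← h]; ring, trivial⟩
  · rintro ⟨⟨p, q⟩, ⟨r, s⟩⟩ h
    simp only [mem_sigma, HasAntidiagonal.mem_antidiagonal] at h ⊢
    obtain ⟨h, rfl⟩ := h
    exact ⟨by rw [← h]; ring, trivial⟩
  · rintro ⟨⟨p, q⟩, ⟨r, s⟩⟩ h
    simp only [mem_sigma, HasAntidiagonal.mem_antidiagonal] at h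
    obtain ⟨h, rfl⟩ := h
    rfl
  · rintro ⟨⟨p, q⟩, ⟨r, s⟩⟩ h
    simp only [mem_sigma, HasAntidiagonal.mem_antidiagonal] at h
    obtain ⟨h, rfl⟩ := h
    rfl
  · rintro ⟨⟨p, q⟩, ⟨r, s⟩⟩ _
    rfl

/-- The coefficient `∏ₛ (bₛ choose γₛ) · aₛ (aₛ - 1) ⋯ (aₛ - γₛ + 1)` in the Leibniz rule
`∂ ^ b · x ^ a = ∑_{γ ≥ 0} (b choose γ) (d ^ γ x ^ a) ∂ ^ (b - γ)`, where `d ^ γ` is the derivation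
`(∂/∂x₁) ^ γ₁ ⋯ (∂/∂xₙ) ^ γₙ`. -/
def leibnizCoeff {n : ℕ} (b a : Fin n → ℤ) (γ : Fin n → ℕ) : ℤ :=
  ∏ s, Ring.choose (b s) (γ s) * (descPochhammer ℤ (γ s)).eval (a s)

theorem leibnizCoeff_zero {n : ℕ} (b a : Fin n → ℤ) : leibnizCoeff b a 0 = 1 := by
  simp [leibnizCoeff]

theorem leibnizCoeff_zero_left {n : ℕ} (a : Fin n → ℤ) {γ : Fin n → ℕ} (h : γ ≠ 0) :
    leibnizCoeff 0 a γ = 0 := by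
  obtain ⟨s, hs⟩ := Function.ne_iff.1 h
  refine Finset.prod_eq_zero (Finset.mem_univ s) ?_
  have : Ring.choose (0 : ℤ) (γ s) = 0 := Ring.choose_zero_pos ℤ (Nat.pos_of_ne_zero hs)
  simp [this]

theorem leibnizCoeff_zero_right {n : ℕ} (b : Fin n → ℤ) {γ : Fin n → ℕ} (h : γ ≠ 0) :
    leibnizCoeff b 0 γ = 0 := by
  obtain ⟨s, hs⟩ := Function.ne_iff.1 h
  refine Finset.prod_eq_zero (Finset.mem_univ s) ?_
  have hs' : γ s ≠ 0 := hs
  have : (descPochhammer ℤ (γ s)).eval 0 = 0 := by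
    exact descPochhammer_ne_zero_eval_zero ℤ hs'
  simp [this]

/-- The pairs of multi-indices with sum `δ`, as functions to pairs. -/
def splittings {n : ℕ} (δ : Fin n → ℕ) : Finset (Fin n → ℕ × ℕ) :=
  Fintype.piFinset fun s => Finset.HasAntidiagonal.antidiagonal (δ s)

theorem leibniz_assoc {n : ℕ} (b₁ b₂ a₂ a₃ : Fin n → ℤ) (δ : Fin n → ℕ) :
    ∑ p ∈ splittings δ, leibnizCoeff b₁ a₂ (fun s => (p s).1) *
        leibnizCoeff (fun s => b₁ s + b₂ s - (p s).1) a₃ (fun s => (p s).2) =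
      ∑ p ∈ splittings δ, leibnizCoeff b₂ a₃ (fun s => (p s).2) *
        leibnizCoeff b₁ (fun s => a₂ s + a₃ s - (p s).2) (fun s => (p s).1) := by
  simp only [leibnizCoeff, ← Finset.prod_mul_distrib, splittings]
  rw [← Finset.prod_univ_sum
      (fun s => Finset.HasAntidiagonal.antidiagonal (δ s)) (fun s (p : ℕ × ℕ) =>
      (Ring.choose (b₁ s) p.1 * (descPochhammer ℤ p.1).eval (a₂ s)) *
        (Ring.choose (b₁ s + b₂ s - p.1) p.2 * (descPochhammer ℤ p.2).eval (a₃ s))),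
    ← Finset.prod_univ_sum
      (fun s => Finset.HasAntidiagonal.antidiagonal (δ s)) (fun s (p : ℕ × ℕ) =>
      (Ring.choose (b₂ s) p.2 * (descPochhammer ℤ p.2).eval (a₃ s)) *
        (Ring.choose (b₁ s) p.1 * (descPochhammer ℤ p.1).eval (a₂ s + a₃ s - p.2)))]
  exact Finset.prod_congr rfl fun s _ => leibniz_assoc_one _ _ _ _ _

/-- The ring `P = k((x₁))⋯((xₙ))((∂₁⁻¹))⋯((∂ₙ⁻¹))` of formal pseudo-differential operators in `n`
variables. An element is a formal sum `∑ a_{ij} x ^ i ∂ ^ j`, given by its coefficients. The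
admissible supports in an iterated Laurent series ring are the sets on which the exponent of the
last variable is bounded below and each slice, where this exponent is fixed, is admissible for the
remaining variables; these are exactly the sets which are well-ordered lexicographically, with the
last variable `∂ₙ⁻¹` as the most significant one. So, as a vector space, `P` is the space of Hahn
series for the order of `Exponent n`; compare `HahnSeries.iterateEquiv`. -/
def PsiDO (n : ℕ) (k : Type*) [Field k] : Type _ := HahnSeries (Exponent n) k

namespace PsiDO

variable {n : ℕ} {k : Type*} [Field k]

instance : AddCommGroup (PsiDO n k) := inferInstanceAs (AddCommGroup (HahnSeries (Exponent n) k))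

instance : Module k (PsiDO n k) := inferInstanceAs (Module k (HahnSeries (Exponent n) k))

/-- The coefficient of an operator at the monomial with exponent `e`. -/
def coeff (L : PsiDO n k) (e : Exponent n) : k := HahnSeries.coeff L e

/-- The set of exponents of the monomials which occur in an operator. -/
def support (L : PsiDO n k) : Set (Exponent n) := {e | L.coeff e ≠ 0}

theorem isPWO_support (L : PsiDO n k) : L.support.IsPWO := HahnSeries.isPWO_support' L

/-- An operator from its coefficients. -/
def mk (f : Exponent n → k) (hf : {e | f e ≠ 0}.IsPWO) : PsiDO n k :=
  (⟨f, hf⟩ : HahnSeries (Exponent n) k)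

@[simp] theorem coeff_mk (f : Exponent n → k) (hf : {e | f e ≠ 0}.IsPWO) (e : Exponent n) :
    (mk f hf).coeff e = f e := rfl

@[ext] theorem ext {L M : PsiDO n k} (h : ∀ e, L.coeff e = M.coeff e) : L = M :=
  HahnSeries.ext (funext h)

@[simp] theorem coeff_zero (e : Exponent n) : (0 : PsiDO n k).coeff e = 0 := rfl
@[simp] theorem coeff_add (L M : PsiDO n k) (e : Exponent n) :
    (L + M).coeff e = L.coeff e + M.coeff e := rfl
@[simp] theorem coeff_neg (L : PsiDO n k) (e : Exponent n) : (-L).coeff e = -L.coeff e := rfl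
@[simp] theorem coeff_sub (L M : PsiDO n k) (e : Exponent n) :
    (L - M).coeff e = L.coeff e - M.coeff e := rfl
@[simp] theorem coeff_smul (c : k) (L : PsiDO n k) (e : Exponent n) :
    (c • L).coeff e = c * L.coeff e := rfl

/-- The triples `(e, f, γ)` which contribute to the coefficient at `g` of a product of two
operators with supports in `S` and `T`. -/
def contributions (S T : Set (Exponent n)) (g : Exponent n) :
    Set (Exponent n × Exponent n × (Fin n → ℕ)) :=
  {t | t.1 ∈ S ∧ t.2.1 ∈ T ∧ t.1 + t.2.1 - Exponent.diag t.2.2 = g}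

open scoped Pointwise in
theorem finite_contributions {S T : Set (Exponent n)} (hS : S.IsPWO) (hT : T.IsPWO)
    (g : Exponent n) : (contributions S T g).Finite := by
  have h1 := Set.AddAntidiagonal.finite_of_isPWO hS (hT.add Exponent.isPWO_range_neg_diag) g
  have h2 : ∀ u, (Set.antidiagonal T (Set.range fun γ : Fin n → ℕ => -Exponent.diag γ) u).Finite :=
    fun u => Set.AddAntidiagonal.finite_of_isPWO hT Exponent.isPWO_range_neg_diag u
  have h3 : (⋃ p ∈ Set.antidiagonal S (T + Set.range fun γ : Fin n → ℕ => -Exponent.diag γ) g,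
      (fun q : Exponent n × Exponent n => (p.1, q)) ''
        Set.antidiagonal T (Set.range fun γ : Fin n → ℕ => -Exponent.diag γ) p.2).Finite :=
    h1.biUnion fun p _ => (h2 p.2).image _
  refine Set.Finite.of_finite_image (f := fun t : Exponent n × Exponent n × (Fin n → ℕ) =>
    (t.1, t.2.1, -Exponent.diag t.2.2)) (h3.subset ?_) ?_
  · rintro _ ⟨⟨e, f, γ⟩, ⟨he, hf, h⟩, rfl⟩
    simp only [Set.mem_iUnion]
    refine ⟨(e, f + -Exponent.diag γ), ⟨he, Set.add_mem_add hf ⟨γ, rfl⟩, ?_⟩,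
      (f, -Exponent.diag γ), ⟨hf, ⟨γ, rfl⟩, rfl⟩, rfl⟩
    simp only at h ⊢
    rw [← h]
    abel
  · rintro ⟨e, f, γ⟩ _ ⟨e', f', γ'⟩ _ h
    simp only [Prod.mk.injEq, neg_inj] at h
    obtain ⟨rfl, rfl, h⟩ := h
    rw [Exponent.diag_injective h]

open Classical in
/-- The summand of the coefficient at `g` of `L * M` that belongs to `t = (e, f, γ)`: it is the
coefficient at `g` of the `γ`-th term of the Leibniz rule for the product of the monomials of `L`
and `M` with exponents `e` and `f`,
`x ^ a ∂ ^ b · x ^ a' ∂ ^ b' = ∑_{γ ≥ 0} (b choose γ) x ^ a (d ^ γ x ^ a') ∂ ^ (b + b' - γ)`. -/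
def mulTerm (L M : PsiDO n k) (g : Exponent n) (t : Exponent n × Exponent n × (Fin n → ℕ)) : k :=
  if t.1 + t.2.1 - Exponent.diag t.2.2 = g then
    (leibnizCoeff t.1.d t.2.1.x t.2.2 : k) * (L.coeff t.1 * M.coeff t.2.1)
  else 0

theorem support_mulTerm (L M : PsiDO n k) (g : Exponent n) :
    Function.support (mulTerm L M g) ⊆ contributions L.support M.support g := by
  intro t ht
  rw [Function.mem_support, mulTerm] at ht
  split_ifs at ht with h
  · exact ⟨left_ne_zero_of_mul (right_ne_zero_of_mul ht),
      right_ne_zero_of_mul (right_ne_zero_of_mul ht), h⟩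
  · exact absurd rfl ht

theorem exists_mulTerm_ne_zero {L M : PsiDO n k} {g : Exponent n}
    (h : (∑ᶠ t, mulTerm L M g t) ≠ 0) : ∃ t, mulTerm L M g t ≠ 0 := by
  by_contra! h'
  exact h (finsum_eq_zero_of_forall_eq_zero h')

open scoped Pointwise in
/-- Multiplication of operators by the Leibniz rule. -/
instance : Mul (PsiDO n k) where
  mul L M := mk (fun g => ∑ᶠ t, mulTerm L M g t) (by
    refine ((L.isPWO_support.add M.isPWO_support).add Exponent.isPWO_range_neg_diag).mono ?_
    intro g hg
    obtain ⟨t, ht⟩ := exists_mulTerm_ne_zero hg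
    obtain ⟨h1, h2, h3⟩ := support_mulTerm L M g ht
    exact ⟨t.1 + t.2.1, Set.add_mem_add h1 h2, -Exponent.diag t.2.2, ⟨_, rfl⟩, by
      rw [← h3]; exact (sub_eq_add_neg _ _).symm⟩)

theorem coeff_mul (L M : PsiDO n k) (g : Exponent n) :
    (L * M).coeff g = ∑ᶠ t, mulTerm L M g t := rfl

theorem coeff_mul_eq_sum (L M : PsiDO n k) (g : Exponent n)
    {s : Finset (Exponent n × Exponent n × (Fin n → ℕ))}
    (hs : contributions L.support M.support g ⊆ s) :
    (L * M).coeff g = ∑ t ∈ s, mulTerm L M g t :=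
  finsum_eq_sum_of_support_subset _ ((support_mulTerm L M g).trans hs)

open Classical in
instance : One (PsiDO n k) where
  one := mk (fun e => if e = 0 then 1 else 0)
    ((Set.finite_singleton (0 : Exponent n)).isPWO.mono fun e he => by
      by_contra h
      exact he (if_neg h))

open Classical in
theorem coeff_one (e : Exponent n) : (1 : PsiDO n k).coeff e = if e = 0 then 1 else 0 := rfl

protected theorem left_distrib (L M N : PsiDO n k) : L * (M + N) = L * M + L * N := by
  ext g
  have hT := (M.isPWO_support.union N.isPWO_support)
  have hf := finite_contributions L.isPWO_support hT g
  rw [coeff_add, coeff_mul_eq_sum L (M + N) g (s := hf.toFinset),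
    coeff_mul_eq_sum L M g (s := hf.toFinset), coeff_mul_eq_sum L N g (s := hf.toFinset),
    ← Finset.sum_add_distrib]
  · refine Finset.sum_congr rfl fun t _ => ?_
    simp only [mulTerm, coeff_add]
    split_ifs <;> ring
  · rintro t ⟨h1, h2, h3⟩
    exact hf.mem_toFinset.2 ⟨h1, Or.inr h2, h3⟩
  · rintro t ⟨h1, h2, h3⟩
    exact hf.mem_toFinset.2 ⟨h1, Or.inl h2, h3⟩
  · rintro t ⟨h1, h2, h3⟩
    refine hf.mem_toFinset.2 ⟨h1, ?_, h3⟩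
    by_contra h
    simp only [support, Set.mem_union, Set.mem_ofPred_eq, not_or, not_not] at h
    exact h2 (by rw [coeff_add, h.1, h.2, add_zero])

protected theorem right_distrib (L M N : PsiDO n k) : (L + M) * N = L * N + M * N := by
  ext g
  have hT := (L.isPWO_support.union M.isPWO_support)
  have hf := finite_contributions hT N.isPWO_support g
  rw [coeff_add, coeff_mul_eq_sum (L + M) N g (s := hf.toFinset),
    coeff_mul_eq_sum L N g (s := hf.toFinset), coeff_mul_eq_sum M N g (s := hf.toFinset),
    ← Finset.sum_add_distrib]
  · refine Finset.sum_congr rfl fun t _ => ?_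
    simp only [mulTerm, coeff_add]
    split_ifs <;> ring
  · rintro t ⟨h1, h2, h3⟩
    exact hf.mem_toFinset.2 ⟨Or.inr h1, h2, h3⟩
  · rintro t ⟨h1, h2, h3⟩
    exact hf.mem_toFinset.2 ⟨Or.inl h1, h2, h3⟩
  · rintro t ⟨h1, h2, h3⟩
    refine hf.mem_toFinset.2 ⟨?_, h2, h3⟩
    by_contra h
    simp only [support, Set.mem_union, Set.mem_ofPred_eq, not_or, not_not] at h
    exact h1 (by rw [coeff_add, h.1, h.2, add_zero])

protected theorem one_mul (L : PsiDO n k) : 1 * L = L := by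
  ext g
  rw [coeff_mul, finsum_eq_single _ ((0 : Exponent n), g, (0 : Fin n → ℕ))]
  · have h0 : Exponent.diag (0 : Fin n → ℕ) = 0 := rfl
    simp [mulTerm, coeff_one, h0, leibnizCoeff_zero]
  · rintro ⟨e, f, γ⟩ h
    simp only [mulTerm, coeff_one]
    split_ifs with h1 h2
    · subst h2
      by_cases hγ : γ = 0
      · subst hγ
        refine absurd ?_ h
        have h0 : Exponent.diag (0 : Fin n → ℕ) = 0 := rfl
        rw [h0, zero_add, sub_zero] at h1
        rw [h1]
      · rw [Exponent.d_zero, leibnizCoeff_zero_left _ hγ]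
        simp
    · simp
    · rfl

protected theorem mul_one (L : PsiDO n k) : L * 1 = L := by
  ext g
  rw [coeff_mul, finsum_eq_single _ (g, (0 : Exponent n), (0 : Fin n → ℕ))]
  · have h0 : Exponent.diag (0 : Fin n → ℕ) = 0 := rfl
    simp [mulTerm, coeff_one, h0, leibnizCoeff_zero]
  · rintro ⟨e, f, γ⟩ h
    simp only [mulTerm, coeff_one]
    split_ifs with h1 h2
    · subst h2
      by_cases hγ : γ = 0
      · subst hγ
        refine absurd ?_ h
        have h0 : Exponent.diag (0 : Fin n → ℕ) = 0 := rfl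
        rw [h0, add_zero, sub_zero] at h1
        rw [h1]
      · rw [Exponent.x_zero, leibnizCoeff_zero_right _ hγ]
        simp
    · simp
    · rfl

/-- The data `(e₁, e₂, e₃, p)` which contribute to the coefficient at `g` of a triple product. -/
def contributions₃ (L M N : PsiDO n k) (g : Exponent n) :
    Set (Exponent n × Exponent n × Exponent n × (Fin n → ℕ × ℕ)) :=
  {q | q.1 ∈ L.support ∧ q.2.1 ∈ M.support ∧ q.2.2.1 ∈ N.support ∧
    q.1 + q.2.1 + q.2.2.1 - Exponent.diag (fun s => (q.2.2.2 s).1 + (q.2.2.2 s).2) = g}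

theorem diag_fst_add_snd (p : Fin n → ℕ × ℕ) :
    Exponent.diag (fun s => (p s).1 + (p s).2) =
      Exponent.diag (fun s => (p s).1) + Exponent.diag (fun s => (p s).2) :=
  Exponent.diag_add (fun s => (p s).1) (fun s => (p s).2)

open scoped Pointwise in
theorem finite_contributions₃ (L M N : PsiDO n k) (g : Exponent n) :
    (contributions₃ L M N g).Finite := by
  have h1 := finite_contributions ((L.isPWO_support.add M.isPWO_support).add
    Exponent.isPWO_range_neg_diag) N.isPWO_support g
  have h2 : ∀ u, (contributions L.support M.support u).Finite :=
    fun u => finite_contributions L.isPWO_support M.isPWO_support u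
  refine (h1.biUnion fun t _ => (h2 t.1).image
    fun r => (r.1, r.2.1, t.2.1, fun s => (r.2.2 s, t.2.2 s))).subset ?_
  rintro ⟨e₁, e₂, e₃, p⟩ ⟨he₁, he₂, he₃, h⟩
  simp only [Set.mem_iUnion]
  refine ⟨(e₁ + e₂ - Exponent.diag fun s => (p s).1, e₃, fun s => (p s).2),
    ⟨?_, he₃, ?_⟩, (e₁, e₂, fun s => (p s).1), ⟨he₁, he₂, rfl⟩, rfl⟩
  · exact ⟨e₁ + e₂, Set.add_mem_add he₁ he₂, _, ⟨_, rfl⟩, (sub_eq_add_neg _ _).symm⟩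
  · simp only [diag_fst_add_snd] at h ⊢
    rw [← h]
    abel

theorem coeff_mul_mul_left (L M N : PsiDO n k) (g : Exponent n) :
    (L * M * N).coeff g = ∑ q ∈ (finite_contributions₃ L M N g).toFinset,
      ((leibnizCoeff q.1.d q.2.1.x (fun s => (q.2.2.2 s).1) *
        leibnizCoeff (fun s => q.1.d s + q.2.1.d s - (q.2.2.2 s).1) q.2.2.1.x
          (fun s => (q.2.2.2 s).2) : ℤ) : k) *
        (L.coeff q.1 * M.coeff q.2.1 * N.coeff q.2.2.1) := by
  classical
  have hfin : ∀ u, (contributions L.support M.support u).Finite :=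
    fun u => finite_contributions L.isPWO_support M.isPWO_support u
  set S : Finset (Exponent n × Exponent n × (Fin n → ℕ)) :=
    (finite_contributions₃ L M N g).toFinset.image fun q =>
      (q.1 + q.2.1 - Exponent.diag (fun s => (q.2.2.2 s).1), q.2.2.1, fun s => (q.2.2.2 s).2)
    with hSdef
  have hS : ∀ t ∈ S, t.2.1 ∈ N.support ∧ t.1 + t.2.1 - Exponent.diag t.2.2 = g := by
    intro t ht
    obtain ⟨⟨e₁, e₂, e₃, p⟩, hq, rfl⟩ := Finset.mem_image.1 ht
    obtain ⟨-, -, h3, h⟩ := (Set.Finite.mem_toFinset _).1 hq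
    refine ⟨h3, ?_⟩
    simp only [diag_fst_add_snd] at h ⊢
    rw [← h]
    abel
  have hS' : ∀ (t : Exponent n × Exponent n × (Fin n → ℕ)), ∀ r ∈ (hfin t.1).toFinset,
      t.2.1 ∈ N.support → t.1 + t.2.1 - Exponent.diag t.2.2 = g →
      (r.1, r.2.1, t.2.1, fun s => (r.2.2 s, t.2.2 s)) ∈ contributions₃ L M N g := by
    rintro ⟨u, e₃, γ₂⟩ ⟨e₁, e₂, γ₁⟩ hr hN hg
    obtain ⟨h1, h2, h3⟩ := (Set.Finite.mem_toFinset _).1 hr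
    refine ⟨h1, h2, hN, ?_⟩
    simp only at h3 hg ⊢
    rw [← hg, ← h3, diag_fst_add_snd (fun s => (γ₁ s, γ₂ s))]
    abel
  rw [coeff_mul_eq_sum (L * M) N g (s := S)]
  · have e1 : ∀ t ∈ S, mulTerm (L * M) N g t = ∑ r ∈ (hfin t.1).toFinset,
        (leibnizCoeff t.1.d t.2.1.x t.2.2 : k) *
        ((leibnizCoeff r.1.d r.2.1.x r.2.2 : k) * (L.coeff r.1 * M.coeff r.2.1) *
          N.coeff t.2.1) := by
      intro t ht
      rw [mulTerm, if_pos (hS t ht).2,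
        coeff_mul_eq_sum L M t.1 (s := (hfin t.1).toFinset) (by simp), Finset.sum_mul,
        Finset.mul_sum]
      refine Finset.sum_congr rfl fun r hr => ?_
      rw [mulTerm, if_pos ((Set.Finite.mem_toFinset _).1 hr).2.2]
    rw [Finset.sum_congr rfl e1, Finset.sum_sigma']
    refine Finset.sum_bij' (fun a _ => (a.2.1, a.2.2.1, a.1.2.1, fun s => (a.2.2.2 s, a.1.2.2 s)))
      (fun q _ => ⟨(q.1 + q.2.1 - Exponent.diag (fun s => (q.2.2.2 s).1), q.2.2.1,
        fun s => (q.2.2.2 s).2), (q.1, q.2.1, fun s => (q.2.2.2 s).1)⟩) ?_ ?_ ?_ ?_ ?_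
    · rintro ⟨t, r⟩ h
      obtain ⟨ht, hr⟩ := Finset.mem_sigma.1 h
      exact (Set.Finite.mem_toFinset _).2 (hS' t r hr (hS t ht).1 (hS t ht).2)
    · intro q hq
      refine Finset.mem_sigma.2 ⟨Finset.mem_image.2 ⟨q, hq, rfl⟩, ?_⟩
      obtain ⟨h1, h2, -, -⟩ := (Set.Finite.mem_toFinset _).1 hq
      exact (Set.Finite.mem_toFinset _).2 ⟨h1, h2, rfl⟩
    · rintro ⟨⟨u, e₃, γ₂⟩, ⟨e₁, e₂, γ₁⟩⟩ h
      obtain ⟨ht, hr⟩ := Finset.mem_sigma.1 h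
      obtain ⟨-, -, h3⟩ := (Set.Finite.mem_toFinset _).1 hr
      simp only at h3
      subst h3
      rfl
    · rintro ⟨e₁, e₂, e₃, p⟩ _
      rfl
    · rintro ⟨⟨u, e₃, γ₂⟩, ⟨e₁, e₂, γ₁⟩⟩ h
      obtain ⟨ht, hr⟩ := Finset.mem_sigma.1 h
      obtain ⟨-, -, h3⟩ := (Set.Finite.mem_toFinset _).1 hr
      simp only at h3
      have hd : u.d = fun s => e₁.d s + e₂.d s - (γ₁ s : ℤ) := by
        rw [← h3]
        rfl
      simp only [hd]
      push_cast
      ring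
  · rintro ⟨u, e₃, γ₂⟩ ⟨h1, h2, h3⟩
    obtain ⟨r, hr⟩ := exists_mulTerm_ne_zero h1
    have hr' := support_mulTerm L M u hr
    refine Finset.mem_coe.2 (Finset.mem_image.2 ⟨_, (Set.Finite.mem_toFinset _).2
      (hS' (u, e₃, γ₂) r ((Set.Finite.mem_toFinset _).2 hr') h2 h3), ?_⟩)
    have := hr'.2.2
    simp only at this ⊢
    rw [this]

theorem coeff_mul_mul_right (L M N : PsiDO n k) (g : Exponent n) :
    (L * (M * N)).coeff g = ∑ q ∈ (finite_contributions₃ L M N g).toFinset,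
      ((leibnizCoeff q.2.1.d q.2.2.1.x (fun s => (q.2.2.2 s).2) *
        leibnizCoeff q.1.d (fun s => q.2.1.x s + q.2.2.1.x s - (q.2.2.2 s).2)
          (fun s => (q.2.2.2 s).1) : ℤ) : k) *
        (L.coeff q.1 * M.coeff q.2.1 * N.coeff q.2.2.1) := by
  classical
  have hfin : ∀ u, (contributions M.support N.support u).Finite :=
    fun u => finite_contributions M.isPWO_support N.isPWO_support u
  set S : Finset (Exponent n × Exponent n × (Fin n → ℕ)) :=
    (finite_contributions₃ L M N g).toFinset.image fun q =>
      (q.1, q.2.1 + q.2.2.1 - Exponent.diag (fun s => (q.2.2.2 s).2), fun s => (q.2.2.2 s).1)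
    with hSdef
  have hS : ∀ t ∈ S, t.1 ∈ L.support ∧ t.1 + t.2.1 - Exponent.diag t.2.2 = g := by
    intro t ht
    obtain ⟨⟨e₁, e₂, e₃, p⟩, hq, rfl⟩ := Finset.mem_image.1 ht
    obtain ⟨h1, -, -, h⟩ := (Set.Finite.mem_toFinset _).1 hq
    refine ⟨h1, ?_⟩
    simp only [diag_fst_add_snd] at h ⊢
    rw [← h]
    abel
  have hS' : ∀ (t : Exponent n × Exponent n × (Fin n → ℕ)), ∀ r ∈ (hfin t.2.1).toFinset,
      t.1 ∈ L.support → t.1 + t.2.1 - Exponent.diag t.2.2 = g →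
      (t.1, r.1, r.2.1, fun s => (t.2.2 s, r.2.2 s)) ∈ contributions₃ L M N g := by
    rintro ⟨e₁, u, γ₁⟩ ⟨e₂, e₃, γ₂⟩ hr hL hg
    obtain ⟨h1, h2, h3⟩ := (Set.Finite.mem_toFinset _).1 hr
    refine ⟨hL, h1, h2, ?_⟩
    simp only at h3 hg ⊢
    rw [← hg, ← h3, diag_fst_add_snd (fun s => (γ₁ s, γ₂ s))]
    abel
  rw [coeff_mul_eq_sum L (M * N) g (s := S)]
  · have e1 : ∀ t ∈ S, mulTerm L (M * N) g t = ∑ r ∈ (hfin t.2.1).toFinset,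
        (leibnizCoeff t.1.d t.2.1.x t.2.2 : k) * (L.coeff t.1 *
        ((leibnizCoeff r.1.d r.2.1.x r.2.2 : k) * (M.coeff r.1 * N.coeff r.2.1))) := by
      intro t ht
      rw [mulTerm, if_pos (hS t ht).2,
        coeff_mul_eq_sum M N t.2.1 (s := (hfin t.2.1).toFinset) (by simp), Finset.mul_sum,
        Finset.mul_sum]
      refine Finset.sum_congr rfl fun r hr => ?_
      rw [mulTerm, if_pos ((Set.Finite.mem_toFinset _).1 hr).2.2]
    rw [Finset.sum_congr rfl e1, Finset.sum_sigma']
    refine Finset.sum_bij' (fun a _ => (a.1.1, a.2.1, a.2.2.1, fun s => (a.1.2.2 s, a.2.2.2 s)))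
      (fun q _ => ⟨(q.1, q.2.1 + q.2.2.1 - Exponent.diag (fun s => (q.2.2.2 s).2),
        fun s => (q.2.2.2 s).1), (q.2.1, q.2.2.1, fun s => (q.2.2.2 s).2)⟩) ?_ ?_ ?_ ?_ ?_
    · rintro ⟨t, r⟩ h
      obtain ⟨ht, hr⟩ := Finset.mem_sigma.1 h
      exact (Set.Finite.mem_toFinset _).2 (hS' t r hr (hS t ht).1 (hS t ht).2)
    · intro q hq
      refine Finset.mem_sigma.2 ⟨Finset.mem_image.2 ⟨q, hq, rfl⟩, ?_⟩
      obtain ⟨-, h1, h2, -⟩ := (Set.Finite.mem_toFinset _).1 hq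
      exact (Set.Finite.mem_toFinset _).2 ⟨h1, h2, rfl⟩
    · rintro ⟨⟨e₁, u, γ₁⟩, ⟨e₂, e₃, γ₂⟩⟩ h
      obtain ⟨ht, hr⟩ := Finset.mem_sigma.1 h
      obtain ⟨-, -, h3⟩ := (Set.Finite.mem_toFinset _).1 hr
      simp only at h3
      subst h3
      rfl
    · rintro ⟨e₁, e₂, e₃, p⟩ _
      rfl
    · rintro ⟨⟨e₁, u, γ₁⟩, ⟨e₂, e₃, γ₂⟩⟩ h
      obtain ⟨ht, hr⟩ := Finset.mem_sigma.1 h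
      obtain ⟨-, -, h3⟩ := (Set.Finite.mem_toFinset _).1 hr
      simp only at h3
      have hx : u.x = fun s => e₂.x s + e₃.x s - (γ₂ s : ℤ) := by
        rw [← h3]
        rfl
      simp only [hx]
      push_cast
      ring
  · rintro ⟨e₁, u, γ₁⟩ ⟨h1, h2, h3⟩
    obtain ⟨r, hr⟩ := exists_mulTerm_ne_zero h2
    have hr' := support_mulTerm M N u hr
    refine Finset.mem_coe.2 (Finset.mem_image.2 ⟨_, (Set.Finite.mem_toFinset _).2
      (hS' (e₁, u, γ₁) r ((Set.Finite.mem_toFinset _).2 hr') h1 h3), ?_⟩)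
    have := hr'.2.2
    simp only at this ⊢
    rw [this]

theorem sum_contributions₃ (L M N : PsiDO n k) (g : Exponent n) :
    ∃ T : Finset (Exponent n × Exponent n × Exponent n × (Fin n → ℕ)),
      ∀ F : Exponent n → Exponent n → Exponent n → (Fin n → ℕ × ℕ) → k,
      ∑ q ∈ (finite_contributions₃ L M N g).toFinset, F q.1 q.2.1 q.2.2.1 q.2.2.2 =
        ∑ t ∈ T, ∑ p ∈ splittings t.2.2.2, F t.1 t.2.1 t.2.2.1 p := by
  classical
  refine ⟨(finite_contributions₃ L M N g).toFinset.image fun q =>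
    (q.1, q.2.1, q.2.2.1, fun s => (q.2.2.2 s).1 + (q.2.2.2 s).2), fun F => ?_⟩
  rw [Finset.sum_sigma']
  symm
  refine Finset.sum_bij' (fun a _ => (a.1.1, a.1.2.1, a.1.2.2.1, a.2))
    (fun q _ => ⟨(q.1, q.2.1, q.2.2.1, fun s => (q.2.2.2 s).1 + (q.2.2.2 s).2), q.2.2.2⟩)
    ?_ ?_ ?_ ?_ ?_
  · rintro ⟨⟨e₁, e₂, e₃, δ⟩, p⟩ h
    obtain ⟨h1, h2⟩ := Finset.mem_sigma.1 h
    obtain ⟨⟨e₁', e₂', e₃', p'⟩, hq, h3⟩ := Finset.mem_image.1 h1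
    simp only [Prod.mk.injEq] at h3
    obtain ⟨rfl, rfl, rfl, h3⟩ := h3
    obtain ⟨k1, k2, k3, k4⟩ := (Set.Finite.mem_toFinset _).1 hq
    refine (Set.Finite.mem_toFinset _).2 ⟨k1, k2, k3, ?_⟩
    have : (fun s => (p s).1 + (p s).2) = δ := funext fun s =>
      Finset.HasAntidiagonal.mem_antidiagonal.1 (Fintype.mem_piFinset.1 h2 s)
    simp only [this]
    simp only [h3] at k4
    exact k4
  · intro q hq
    refine Finset.mem_sigma.2 ⟨Finset.mem_image.2 ⟨q, hq, rfl⟩, Fintype.mem_piFinset.2 fun s =>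
      Finset.HasAntidiagonal.mem_antidiagonal.2 rfl⟩
  · rintro ⟨⟨e₁, e₂, e₃, δ⟩, p⟩ h
    obtain ⟨h1, h2⟩ := Finset.mem_sigma.1 h
    have : (fun s => (p s).1 + (p s).2) = δ := funext fun s =>
      Finset.HasAntidiagonal.mem_antidiagonal.1 (Fintype.mem_piFinset.1 h2 s)
    subst this
    rfl
  · rintro ⟨e₁, e₂, e₃, p⟩ _
    rfl
  · rintro ⟨⟨e₁, e₂, e₃, δ⟩, p⟩ _
    rfl

protected theorem mul_assoc (L M N : PsiDO n k) : L * M * N = L * (M * N) := by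
  ext g
  obtain ⟨T, hT⟩ := sum_contributions₃ L M N g
  rw [coeff_mul_mul_left, coeff_mul_mul_right,
    hT fun e₁ e₂ e₃ p => ((leibnizCoeff e₁.d e₂.x (fun s => (p s).1) *
        leibnizCoeff (fun s => e₁.d s + e₂.d s - (p s).1) e₃.x (fun s => (p s).2) : ℤ) : k) *
        (L.coeff e₁ * M.coeff e₂ * N.coeff e₃),
    hT fun e₁ e₂ e₃ p => ((leibnizCoeff e₂.d e₃.x (fun s => (p s).2) *
        leibnizCoeff e₁.d (fun s => e₂.x s + e₃.x s - (p s).2) (fun s => (p s).1) : ℤ) : k) *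
        (L.coeff e₁ * M.coeff e₂ * N.coeff e₃)]
  refine Finset.sum_congr rfl fun t _ => ?_
  rw [← Finset.sum_mul, ← Finset.sum_mul, ← Int.cast_sum, ← Int.cast_sum, leibniz_assoc]

/-- The associative ring of formal pseudo-differential operators. -/
instance : Ring (PsiDO n k) where
  __ := (inferInstance : AddCommGroup (PsiDO n k))
  left_distrib := PsiDO.left_distrib
  right_distrib := PsiDO.right_distrib
  zero_mul L := by
    have h := PsiDO.right_distrib 0 0 L
    rwa [add_zero, left_eq_add] at h
  mul_zero L := by
    have h := PsiDO.left_distrib L 0 0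
    rwa [add_zero, left_eq_add] at h
  mul_assoc := PsiDO.mul_assoc
  one_mul := PsiDO.one_mul
  mul_one := PsiDO.mul_one

/-- The residue of an operator: its coefficient at `x₁⁻¹ ⋯ xₙ⁻¹ ∂₁⁻¹ ⋯ ∂ₙ⁻¹`. -/
def res (L : PsiDO n k) : k := L.coeff (-Exponent.diag 1)

open Classical in
/-- The projection of `P = P₊ ⊕ P₋` to `P₊`, the operators which contain only nonnegative powers of
the last variable `∂ₙ`. -/
def plus (L : PsiDO n k) : PsiDO n k :=
  mk (fun e => if ∀ s : Fin n, (s : ℕ) + 1 = n → 0 ≤ e.d s then L.coeff e else 0)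
    (L.isPWO_support.mono fun e he => by
      by_contra h
      refine he ?_
      split_ifs
      · exact not_not.1 h
      · rfl)

/-- The projection of `P = P₊ ⊕ P₋` to `P₋`, the operators which contain only negative powers of
the last variable `∂ₙ`. -/
def minus (L : PsiDO n k) : PsiDO n k := L - plus L

/-- The difference of the projectors to `P₊` and to `P₋`. -/
def rMatrix (L : PsiDO n k) : PsiDO n k := plus L - minus L

/-- The `R`-bracket `½ [R X, Y] + ½ [X, R Y]` on `P`. -/
def rBracket (X Y : PsiDO n k) : PsiDO n k :=
  (1 / 2 : k) • ⁅rMatrix X, Y⁆ + (1 / 2 : k) • ⁅X, rMatrix Y⁆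

end PsiDO

/-- The space `Pⁿ` of `n`-tuples of operators; it is also the tangent space at each of its
points. -/
abbrev PhaseSpace (n : ℕ) (k : Type*) [Field k] : Type _ := Fin n → PsiDO n k

namespace PhaseSpace

variable {n : ℕ} {k : Type*} [Field k]

/-- The subvariety `P'` of `Pⁿ` of the tuples of pairwise commuting operators. -/
def commuting (n : ℕ) (k : Type*) [Field k] : Set (PhaseSpace n k) :=
  {L | ∀ i j, ⁅L i, L j⁆ = 0}

/-- The operator `L ^ m = L₁ ^ m₁ ⋯ Lₙ ^ mₙ`, multiplied in this order. -/
def monomial (L : PhaseSpace n k) (m : Fin n → ℕ) : PsiDO n k :=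
  (List.ofFn fun i => L i ^ m i).prod

/-- The function `H_m(L) = res (L ^ m)` on `Pⁿ`. -/
def hamiltonian (m : Fin n → ℕ) (L : PhaseSpace n k) : k := (L.monomial m).res

/-- The bilinear form `⟨L, M⟩ = ∑ᵢ res (Lᵢ Mᵢ)` on `Pⁿ`. -/
def pairing (L M : PhaseSpace n k) : k := ∑ i, (L i * M i).res

/-- The value at `L` of a monomial `μ` in the coefficients of the operators `L₁, …, Lₙ`; the
variable `(i, e)` stands for the coefficient of `Lᵢ` at the monomial with exponent `e`. -/
def coordMonomial (L : PhaseSpace n k) (μ : Fin n × Exponent n →₀ ℕ) : k :=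
  μ.prod fun v r => (L v.1).coeff v.2 ^ r

/-- `F` is the function on `Pⁿ` given by the formal polynomial `∑ c_μ μ` of bounded degree in the
coefficients of the operators `L₁, …, Lₙ`. Any number of coefficients may occur, but at each point
of `Pⁿ` only finitely many summands are nonzero. -/
structure IsGivenBy (F : PhaseSpace n k → k) (c : (Fin n × Exponent n →₀ ℕ) → k) : Prop where
  bounded_degree : ∃ N : ℕ, ∀ μ, c μ ≠ 0 → μ.degree ≤ N
  finite_support : ∀ L : PhaseSpace n k, {μ | c μ * L.coordMonomial μ ≠ 0}.Finite
  eq_finsum : ∀ L : PhaseSpace n k, F L = ∑ᶠ μ, c μ * L.coordMonomial μ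

/-- The vector space `𝓕(Pⁿ)` of functionals: the functions on `Pⁿ` which are polynomial in any
number of coefficients of the operators `L₁, …, Lₙ`. -/
def functionals (n : ℕ) (k : Type*) [Field k] : Submodule k (PhaseSpace n k → k) where
  carrier := {F | ∃ c, IsGivenBy F c}
  zero_mem' := ⟨0, ⟨0, fun _ h => absurd rfl h⟩, fun L => by simp, fun L => by simp⟩
  add_mem' := by
    rintro F G ⟨c, ⟨N, hN⟩, hc, hF⟩ ⟨c', ⟨N', hN'⟩, hc', hG⟩
    refine ⟨c + c', ⟨max N N', fun μ hμ => ?_⟩, fun L => ?_, fun L => ?_⟩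
    · by_cases h : c μ = 0
      · by_cases h' : c' μ = 0
        · exact absurd (show c μ + c' μ = 0 by rw [h, h', add_zero]) hμ
        · exact (hN' μ h').trans (le_max_right _ _)
      · exact (hN μ h).trans (le_max_left _ _)
    · refine ((hc L).union (hc' L)).subset fun μ hμ => ?_
      by_contra h
      simp only [Set.mem_union, Set.mem_ofPred_eq, not_or, not_not] at h
      refine hμ ?_
      change (c μ + c' μ) * _ = 0
      rw [add_mul, h.1, h.2, add_zero]
    · rw [Pi.add_apply, hF, hG, ← finsum_add_distrib (hc L) (hc' L)]
      exact finsum_congr fun μ => (add_mul _ _ _).symm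
  smul_mem' := by
    rintro a F ⟨c, ⟨N, hN⟩, hc, hF⟩
    have e : ∀ (L : PhaseSpace n k) (μ : Fin n × Exponent n →₀ ℕ),
        (a • c) μ * L.coordMonomial μ = a * (c μ * L.coordMonomial μ) :=
      fun L μ => mul_assoc _ _ _
    refine ⟨a • c, ⟨N, fun μ hμ => hN μ fun h => hμ ?_⟩, fun L => ?_, fun L => ?_⟩
    · change a * c μ = 0
      rw [h, mul_zero]
    · refine (hc L).subset fun μ hμ h => hμ ?_
      rw [e, h, mul_zero]
    · rw [Pi.smul_apply, hF, finsum_congr (e L), smul_eq_mul, mul_finsum]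

/-- `a` is the derivative `d/dε F(L + ε M)` at `ε = 0`: the function `ε ↦ F(L + ε M)` is a
polynomial with derivative `a` at `0`. -/
def HasDirDeriv (F : PhaseSpace n k → k) (L M : PhaseSpace n k) (a : k) : Prop :=
  ∃ p : Polynomial k, (∀ ε : k, F (L + ε • M) = p.eval ε) ∧ p.derivative.eval 0 = a

/-- `U` is the gradient of `F` at the point `L`. -/
def IsGradient (F : PhaseSpace n k → k) (L U : PhaseSpace n k) : Prop :=
  ∀ M : PhaseSpace n k, HasDirDeriv F L M (pairing M U)

open Classical in
/-- The gradient of `F` at the point `L` (and `0` if there is none). -/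
def gradient (F : PhaseSpace n k → k) (L : PhaseSpace n k) : PhaseSpace n k :=
  if h : ∃ U, IsGradient F L U then h.choose else 0

/-- The Poisson bracket `{F, G}_R (L) = ⟨L, [∇F(L), ∇G(L)]_R⟩`. -/
def poissonBracketR (F G : PhaseSpace n k → k) (L : PhaseSpace n k) : k :=
  pairing L fun i => (gradient F L i).rBracket (gradient G L i)

/-- The velocity `X = ∂L/∂t` of a point `L` of `Pⁿ` obeys the Hamiltonian system
`∂F/∂t = {F, H}_R`, `F ∈ 𝓕(Pⁿ)`, where `∂F/∂t` is the derivative of `F` at `L` along `X`. -/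
def IsHamiltonianVelocity (H : PhaseSpace n k → k) (L X : PhaseSpace n k) : Prop :=
  ∀ F ∈ functionals n k, HasDirDeriv F L X (poissonBracketR F H L)

end PhaseSpace

end

/-
The terms of `res (L * M)` and `res (M * L)` agree one by one, because
`choose (c - 1 - a) c = (-1) ^ c * choose a c`; hence `res` is a trace. Under the pairing
`res (L * M)` the operators `∂ ^ (-1 - j) x ^ (-1 - i)` are dual to the coefficients, so an operator
is determined by its pairings and gradients are unique. They exist because a function in `𝓕(Pⁿ)` is,
on the points with support in a fixed well-ordered set, a polynomial in finitely many coefficients,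
so that its derivative is a sum of coefficients with finitely many terms at each tangent vector.

For commuting `Lᵢ` the trace property gives `∇H_m = V` with `Vᵢ = mᵢ L ^ (m - eᵢ)`, which commutes
with `Lᵢ`. Hence `res (Lᵢ [R U, Vᵢ]) = res (R U [Vᵢ, Lᵢ]) = 0`, while `R = 2 (·)₊ - 1` gives
`res (Lᵢ [U, R Vᵢ]) = res (U [R Vᵢ, Lᵢ]) = 2 res ([Vᵢ₊, Lᵢ] U)`. Thus
`{F, H_m}_R = ⟨[V₊, L], ∇F⟩` is the derivative of `F` along `[V₊, L]`, and the coefficients, as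
elements of `𝓕(Pⁿ)`, separate tangent vectors.
-/

noncomputable section

theorem choose_sub_one_sub (c : ℕ) (a : ℤ) :
    Ring.choose (c - 1 - a) c = Int.negOnePow c • Ring.choose a c := by
  have h := Ring.choose_neg (a - c + 1) c
  rwa [show -(a - c + 1) = c - 1 - a by ring, show a - c + 1 + c - 1 = a by ring] at h

theorem choose_mul_descPochhammer_symm {a a' b b' : ℤ} {c : ℕ} (ha : a + a' = c - 1)
    (hb : b + b' = c - 1) :
    Ring.choose b c * (descPochhammer ℤ c).eval a' =
      Ring.choose b' c * (descPochhammer ℤ c).eval a := by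
  obtain rfl : a' = c - 1 - a := by linarith
  obtain rfl : b' = c - 1 - b := by linarith
  simp only [Polynomial.eval_eq_smeval, Ring.descPochhammer_eq_factorial_smul_choose,
    choose_sub_one_sub, smul_comm c.factorial, smul_mul_assoc, mul_smul_comm]

theorem leibnizCoeff_symm {n : ℕ} {a a' b b' : Fin n → ℤ} {γ : Fin n → ℕ}
    (ha : ∀ s, a s + a' s = γ s - 1) (hb : ∀ s, b s + b' s = γ s - 1) :
    leibnizCoeff b a' γ = leibnizCoeff b' a γ :=
  Finset.prod_congr rfl fun s _ => choose_mul_descPochhammer_symm (ha s) (hb s)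

namespace Exponent

variable {n : ℕ}

/-- The exponent of the factor `x ^ e.x` of the monomial `x ^ e.x ∂ ^ e.d`. -/
def xPart (e : Exponent n) : Exponent n := (e.x, 0)

/-- The exponent of the factor `∂ ^ e.d` of the monomial `x ^ e.x ∂ ^ e.d`. -/
def dPart (e : Exponent n) : Exponent n := (0, e.d)

theorem d_xPart (e : Exponent n) : e.xPart.d = 0 := rfl

theorem x_dPart (e : Exponent n) : e.dPart.x = 0 := rfl

theorem dPart_add_xPart (e : Exponent n) : e.dPart + e.xPart = e :=
  Exponent.ext (zero_add _) (add_zero _)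

theorem isPWO_of_forall_finite_inter {A : Set (Exponent n)}
    (hA : ∀ T : Set (Exponent n), T.IsPWO → (A ∩ T).Finite) (g : Exponent n) :
    ((g - ·) '' A).IsPWO := by
  refine Set.IsWF.isPWO (Set.isWF_iff_no_descending_seq.2 fun f hf hmem => ?_)
  have hmono : StrictMono fun i => g - f i := fun i j hij => sub_lt_sub_left (hf hij) g
  have hT : (Set.range fun i => g - f i).IsPWO := by
    rw [← Set.image_univ]
    exact (Set.isPWO_of_wellQuasiOrderedLE _).image_of_monotone hmono.monotone
  refine Set.infinite_range_of_injective hmono.injective ((hA _ hT).subset ?_)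
  rintro _ ⟨i, rfl⟩
  obtain ⟨e, he, hei⟩ := hmem i
  exact ⟨by simpa [← hei] using he, i, rfl⟩

end Exponent

namespace PsiDO

variable {n : ℕ} {k : Type*} [Field k]

theorem smul_mulTerm_left (c : k) (L M : PsiDO n k) (g : Exponent n)
    (t : Exponent n × Exponent n × (Fin n → ℕ)) :
    mulTerm (c • L) M g t = c * mulTerm L M g t := by
  simp only [mulTerm, coeff_smul]
  split_ifs <;> ring

theorem smul_mulTerm_right (c : k) (L M : PsiDO n k) (g : Exponent n)
    (t : Exponent n × Exponent n × (Fin n → ℕ)) :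
    mulTerm L (c • M) g t = c * mulTerm L M g t := by
  simp only [mulTerm, coeff_smul]
  split_ifs <;> ring

instance : IsScalarTower k (PsiDO n k) (PsiDO n k) where
  smul_assoc c L M := by
    ext g
    simp only [smul_eq_mul, coeff_smul, coeff_mul, mul_finsum, smul_mulTerm_left]

instance : SMulCommClass k (PsiDO n k) (PsiDO n k) where
  smul_comm c L M := by
    ext g
    simp only [smul_eq_mul, coeff_smul, coeff_mul, mul_finsum, smul_mulTerm_right]

@[simp] theorem res_zero : (0 : PsiDO n k).res = 0 := rfl
@[simp] theorem res_add (L M : PsiDO n k) : (L + M).res = L.res + M.res := rfl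
@[simp] theorem res_sub (L M : PsiDO n k) : (L - M).res = L.res - M.res := rfl
@[simp] theorem res_smul (c : k) (L : PsiDO n k) : (c • L).res = c * L.res := rfl

theorem res_mul_comm (L M : PsiDO n k) : (L * M).res = (M * L).res := by
  rw [res, res, coeff_mul, coeff_mul,
    ← finsum_comp_equiv ((Equiv.prodAssoc _ _ _).symm.trans
      (((Equiv.prodComm _ _).prodCongr (Equiv.refl _)).trans (Equiv.prodAssoc _ _ _)))]
  refine finsum_congr fun ⟨e, f, γ⟩ => ?_
  simp only [mulTerm, Equiv.trans_apply, Equiv.prodAssoc_symm_apply, Equiv.prodCongr_apply,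
    Prod.map_apply, Equiv.prodComm_apply, Prod.swap_prod_mk, Equiv.refl_apply,
    Equiv.prodAssoc_apply, add_comm f e]
  split_ifs with h
  · have hef : e + f = Exponent.diag γ - Exponent.diag 1 := by
      rw [sub_eq_iff_eq_add.1 h]; abel
    have hx (s : Fin n) : e.x s + f.x s = γ s - 1 := by
      simpa using congrArg (fun u : Exponent n => u.x s) hef
    have hd (s : Fin n) : e.d s + f.d s = γ s - 1 := by
      simpa using congrArg (fun u : Exponent n => u.d s) hef
    rw [leibnizCoeff_symm hx hd, mul_comm (L.coeff _)]
  · rfl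

theorem res_mul_lie (A B C : PsiDO n k) : (A * ⁅B, C⁆).res = (B * ⁅C, A⁆).res := by
  rw [Ring.lie_def, Ring.lie_def, mul_sub, mul_sub, res_sub, res_sub, ← mul_assoc B C A,
    res_mul_comm A (B * C), ← mul_assoc A C B, res_mul_comm (A * C) B]

open scoped Pointwise in
theorem support_mul_subset (L M : PsiDO n k) :
    (L * M).support ⊆ L.support + M.support + Set.range fun γ : Fin n → ℕ => -Exponent.diag γ := by
  intro g hg
  obtain ⟨t, ht⟩ := exists_mulTerm_ne_zero hg
  obtain ⟨hL, hM, rfl⟩ := support_mulTerm L M g ht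
  exact ⟨_, Set.add_mem_add hL hM, _, ⟨t.2.2, rfl⟩, (sub_eq_add_neg _ _).symm⟩

open Classical in
/-- The operator `x ^ e.x ∂ ^ e.d`. -/
def single (k : Type*) [Field k] (e : Exponent n) : PsiDO n k :=
  mk (Pi.single e 1) ((Set.finite_singleton e).isPWO.mono (by
    simpa [Function.support] using Pi.support_single_subset (i := e) (a := (1 : k))))

theorem coeff_single_self (e : Exponent n) : (single k e).coeff e = 1 := by
  simp [single]

theorem coeff_single_of_ne {e f : Exponent n} (h : f ≠ e) : (single k e).coeff f = 0 := by
  simp [single, h]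

theorem support_single_subset (e : Exponent n) : (single k e).support ⊆ {e} :=
  fun _ hf => by_contra fun h => hf (coeff_single_of_ne h)

theorem coeff_single_mul {e : Exponent n} (he : e.d = 0) (M : PsiDO n k) (g : Exponent n) :
    (single k e * M).coeff g = M.coeff (g - e) := by
  have hdiag : Exponent.diag (0 : Fin n → ℕ) = 0 := rfl
  rw [coeff_mul, finsum_eq_single _ (e, g - e, 0)]
  · simp [mulTerm, hdiag, leibnizCoeff_zero, coeff_single_self]
  · rintro ⟨e', f, γ⟩ h
    by_contra hne
    obtain ⟨he', -, hg⟩ := support_mulTerm _ _ _ hne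
    obtain rfl : e' = e := support_single_subset e he'
    obtain rfl : γ = 0 := by
      by_contra hγ
      exact hne (by simp [mulTerm, he, leibnizCoeff_zero_left _ hγ])
    exact h (by simp [← hg, hdiag])

theorem coeff_mul_single {f : Exponent n} (hf : f.x = 0) (M : PsiDO n k) (g : Exponent n) :
    (M * single k f).coeff g = M.coeff (g - f) := by
  have hdiag : Exponent.diag (0 : Fin n → ℕ) = 0 := rfl
  rw [coeff_mul, finsum_eq_single _ (g - f, f, 0)]
  · simp [mulTerm, hdiag, leibnizCoeff_zero, coeff_single_self]
  · rintro ⟨e, f', γ⟩ h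
    by_contra hne
    obtain ⟨-, hf', hg⟩ := support_mulTerm _ _ _ hne
    obtain rfl : f' = f := support_single_subset f hf'
    obtain rfl : γ = 0 := by
      by_contra hγ
      exact hne (by simp [mulTerm, hf, leibnizCoeff_zero_right _ hγ])
    exact h (by simp [← hg, hdiag])

/-- The operator `∂ ^ (-1 - e.d) x ^ (-1 - e.x)`. The operators of this form are the dual basis of
the coefficients with respect to the residue pairing, see `res_mul_dual`. -/
def dual (k : Type*) [Field k] (e : Exponent n) : PsiDO n k :=
  single k (-Exponent.diag 1 - e).dPart * single k (-Exponent.diag 1 - e).xPart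

theorem res_mul_dual (M : PsiDO n k) (e : Exponent n) : (M * dual k e).res = M.coeff e := by
  rw [dual, ← mul_assoc, res_mul_comm, res, coeff_single_mul (Exponent.d_xPart _),
    coeff_mul_single (Exponent.x_dPart _), sub_sub, add_comm (Exponent.xPart _),
    Exponent.dPart_add_xPart, sub_sub_cancel]

theorem eq_of_forall_res_mul_eq {U V : PsiDO n k}
    (h : ∀ M : PsiDO n k, (M * U).res = (M * V).res) : U = V := by
  ext e
  rw [← res_mul_dual U, ← res_mul_dual V, res_mul_comm U, res_mul_comm V, h]

theorem exists_eq_of_coeff_dual_ne_zero {e g : Exponent n} (h : (dual k e).coeff g ≠ 0) :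
    ∃ γ : Fin n → ℕ, g = -Exponent.diag 1 - e + -Exponent.diag γ := by
  obtain ⟨_, ⟨p, hp, q, hq, rfl⟩, _, ⟨γ, rfl⟩, rfl⟩ := support_mul_subset _ _ h
  obtain rfl := support_single_subset _ hp
  obtain rfl := support_single_subset _ hq
  exact ⟨γ, congrArg (· + -Exponent.diag γ) (Exponent.dPart_add_xPart _)⟩

/-- Left multiplication by an operator is continuous for summable families. -/
theorem coeff_mul_eq_finsum {ι : Type*} {s : ι → PsiDO n k} {U : PsiDO n k} {T : Set (Exponent n)}
    (hT : T.IsPWO) (hs : ∀ i, (s i).support ⊆ T) (hfin : ∀ e, {i | (s i).coeff e ≠ 0}.Finite)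
    (hU : ∀ e, U.coeff e = ∑ᶠ i, (s i).coeff e) (M : PsiDO n k) (g : Exponent n) :
    (M * U).coeff g = ∑ᶠ i, (M * s i).coeff g := by
  have hc := finite_contributions M.isPWO_support hT g
  have hUT : U.support ⊆ T := fun e he => by_contra fun heT =>
    he ((hU e).trans (finsum_eq_zero_of_forall_eq_zero fun i => by_contra fun hi => heT (hs i hi)))
  have hsum (V : PsiDO n k) (hV : V.support ⊆ T) :
      (M * V).coeff g = ∑ t ∈ hc.toFinset, mulTerm M V g t :=
    coeff_mul_eq_sum M V g fun t ht => hc.mem_toFinset.2 ⟨ht.1, hV ht.2.1, ht.2.2⟩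
  rw [hsum U hUT, finsum_congr fun i => hsum (s i) (hs i), finsum_sum_comm]
  · refine Finset.sum_congr rfl fun t _ => ?_
    simp only [mulTerm, hU]
    split_ifs
    · simp only [mul_finsum]
    · simp
  · intro t _
    exact (hfin t.2.1).subset fun i hi => (support_mulTerm M (s i) g hi).2.1

open scoped Pointwise in
theorem exists_forall_res_mul_eq {a : Exponent n → k}
    (ha : ∀ T : Set (Exponent n), T.IsPWO → (Function.support a ∩ T).Finite) :
    ∃ U : PsiDO n k, ∀ M : PsiDO n k, (M * U).res = ∑ᶠ e, M.coeff e * a e := by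
  set T := (-Exponent.diag 1 - ·) '' Function.support a +
    Set.range fun γ : Fin n → ℕ => -Exponent.diag γ
  have hT : T.IsPWO :=
    (Exponent.isPWO_of_forall_finite_inter ha _).add Exponent.isPWO_range_neg_diag
  have hsupp (e : Exponent n) : (a e • dual k e).support ⊆ T := by
    intro g hg
    obtain ⟨γ, rfl⟩ := exists_eq_of_coeff_dual_ne_zero (right_ne_zero_of_mul hg)
    exact Set.add_mem_add ⟨e, left_ne_zero_of_mul hg, rfl⟩ ⟨γ, rfl⟩
  have hfin (g : Exponent n) : {e | (a e • dual k e).coeff g ≠ 0}.Finite := by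
    have hpwo := (Set.isPWO_singleton (-Exponent.diag 1 - g)).add (Exponent.isPWO_range_neg_diag)
    refine (ha _ hpwo).subset fun e he => ⟨left_ne_zero_of_mul he, ?_⟩
    obtain ⟨γ, rfl⟩ := exists_eq_of_coeff_dual_ne_zero (right_ne_zero_of_mul he)
    exact ⟨_, rfl, _, ⟨γ, rfl⟩, by simp only; abel⟩
  refine ⟨mk (fun g => ∑ᶠ e, (a e • dual k e).coeff g) (hT.mono fun g hg => ?_), fun M => ?_⟩
  · exact by_contra fun hgT =>
      hg (finsum_eq_zero_of_forall_eq_zero fun e => by_contra fun he => hgT (hsupp e he))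
  · rw [res, coeff_mul_eq_finsum hT hsupp hfin fun _ => rfl]
    refine finsum_congr fun e => ?_
    rw [mul_smul_comm, coeff_smul, ← res, res_mul_dual, mul_comm]

end PsiDO

open MvPolynomial in
theorem coeff_eq_zero_of_eval_eq_zero {σ R : Type*} [CommRing R] [IsDomain R] [Infinite R]
    {p : MvPolynomial σ R} {W : Set σ}
    (h : ∀ f : σ → R, Function.support f ⊆ W → eval f p = 0) {μ : σ →₀ ℕ}
    (hμ : (μ.support : Set σ) ⊆ W) : coeff μ p = 0 := by
  classical
  let q : MvPolynomial σ R := ∑ ν ∈ p.support with (ν.support : Set σ) ⊆ W, monomial ν (coeff ν p)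
  have hcoeff : coeff μ q = coeff μ p := by
    simp +contextual [q, coeff_sum, coeff_monomial, hμ, eq_comm]
  have heval (f : σ → R) : eval f q = eval (W.indicator f) p := by
    rw [map_sum, eval_eq (W.indicator f), Finset.sum_filter]
    refine Finset.sum_congr rfl fun ν _ => ?_
    split_ifs with hν
    · rw [eval_monomial, Finsupp.prod]
      exact congrArg _ (Finset.prod_congr rfl fun v hv => by rw [Set.indicator_of_mem (hν hv)])
    · obtain ⟨v, hv, hvW⟩ := Set.not_subset.1 hν
      rw [Finset.prod_eq_zero hv, mul_zero]
      rw [Set.indicator_of_notMem hvW, zero_pow (Finsupp.mem_support_iff.1 hv)]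
  have hq : q = 0 := MvPolynomial.funext fun f => by
    rw [heval, h _ Set.support_indicator_subset, map_zero]
  rw [← hcoeff, hq, coeff_zero]

namespace PhaseSpace

variable {n : ℕ} {k : Type*} [Field k]

/-- The coefficients of the operators `L₁, …, Lₙ`, as a single family. -/
def coord (L : PhaseSpace n k) (v : Fin n × Exponent n) : k := (L v.1).coeff v.2

/-- The sets of variables that occur as supports of points of `Pⁿ`. -/
def IsAdmissible (W : Set (Fin n × Exponent n)) : Prop := ∀ i, {e | (i, e) ∈ W}.IsPWO

/-- The points of `Pⁿ` at which only the coefficients in `W` may be nonzero. -/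
def supportedIn (k : Type*) [Field k] (W : Set (Fin n × Exponent n)) : Set (PhaseSpace n k) :=
  {L | Function.support L.coord ⊆ W}

/-- A function on `Pⁿ` is locally polynomial of degree at most `N` if, on the points with support
in a given admissible set, it is a polynomial of degree at most `N` in finitely many
coefficients. By `mem_functionals_iff` this is a description of `𝓕(Pⁿ)` without infinite sums. -/
def IsLocallyPolynomial (F : PhaseSpace n k → k) (N : ℕ) : Prop :=
  ∀ W, IsAdmissible W → ∃ p : MvPolynomial (Fin n × Exponent n) k, p.totalDegree ≤ N ∧
    ∀ L ∈ supportedIn k W, F L = p.eval L.coord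

theorem coord_add_smul (L M : PhaseSpace n k) (ε : k) :
    (L + ε • M).coord = fun v => L.coord v + M.coord v * ε :=
  funext fun v => congrArg (L.coord v + ·) (mul_comm ε (M.coord v))

theorem isAdmissible_support_coord (L : PhaseSpace n k) :
    IsAdmissible (Function.support L.coord) :=
  fun i => (L i).isPWO_support

theorem isAdmissible_of_finite {W : Set (Fin n × Exponent n)} (hW : W.Finite) :
    IsAdmissible W :=
  fun i => (hW.preimage (Prod.mk_right_injective i).injOn).isPWO

theorem IsAdmissible.union {W W' : Set (Fin n × Exponent n)} (hW : IsAdmissible W)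
    (hW' : IsAdmissible W') : IsAdmissible (W ∪ W') :=
  fun i => (hW i).union (hW' i)

theorem exists_coord_eq {f : Fin n × Exponent n → k} (hf : IsAdmissible (Function.support f)) :
    ∃ L : PhaseSpace n k, L.coord = f :=
  ⟨fun i => PsiDO.mk (fun e => f (i, e)) (hf i), rfl⟩

theorem exists_support_coord_eq (k : Type*) [Field k] {W : Set (Fin n × Exponent n)}
    (hW : IsAdmissible W) : ∃ L : PhaseSpace n k, Function.support L.coord = W := by
  classical
  have hsupp : Function.support (W.indicator (1 : Fin n × Exponent n → k)) = W := by simp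
  obtain ⟨L, hL⟩ := exists_coord_eq (hsupp.symm ▸ hW)
  exact ⟨L, hL ▸ hsupp⟩

theorem coordMonomial_ne_zero {L : PhaseSpace n k} {μ : Fin n × Exponent n →₀ ℕ} :
    L.coordMonomial μ ≠ 0 ↔ (μ.support : Set _) ⊆ Function.support L.coord := by
  rw [coordMonomial, Finsupp.prod, Finset.prod_ne_zero_iff]
  exact forall₂_congr fun v hv => pow_ne_zero_iff (Finsupp.mem_support_iff.1 hv)

theorem eval_coord_monomial (L : PhaseSpace n k) (μ : Fin n × Exponent n →₀ ℕ) (a : k) :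
    (MvPolynomial.monomial μ a).eval L.coord = a * L.coordMonomial μ :=
  MvPolynomial.eval_monomial

theorem eval_coord_eq_finsum (L : PhaseSpace n k) (p : MvPolynomial (Fin n × Exponent n) k) :
    p.eval L.coord = ∑ᶠ μ, p.coeff μ * L.coordMonomial μ := by
  rw [MvPolynomial.eval_eq, finsum_eq_sum_of_support_subset (s := p.support)]
  · rfl
  · exact fun μ hμ => MvPolynomial.mem_support_iff.2 (left_ne_zero_of_mul hμ)

theorem IsGivenBy.exists_isLocallyPolynomial {F : PhaseSpace n k → k}
    {c : (Fin n × Exponent n →₀ ℕ) → k} (h : IsGivenBy F c) : ∃ N, IsLocallyPolynomial F N := by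
  obtain ⟨N, hN⟩ := h.bounded_degree
  refine ⟨N, fun W hW => ?_⟩
  obtain ⟨L₀, rfl⟩ := exists_support_coord_eq k hW
  have hfin := h.finite_support L₀
  refine ⟨∑ μ ∈ hfin.toFinset, MvPolynomial.monomial μ (c μ),
    MvPolynomial.totalDegree_finsetSum_le fun μ hμ => ?_, fun L hL => ?_⟩
  · exact (MvPolynomial.totalDegree_monomial_le μ _).trans
      (hN μ (left_ne_zero_of_mul (hfin.mem_toFinset.1 hμ)))
  · simp only [map_sum, eval_coord_monomial]
    rw [h.eq_finsum, finsum_eq_sum_of_support_subset]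
    refine fun μ hμ => hfin.mem_toFinset.2 (mul_ne_zero (left_ne_zero_of_mul hμ) ?_)
    exact coordMonomial_ne_zero.2 ((coordMonomial_ne_zero.1 (right_ne_zero_of_mul hμ)).trans hL)

/-- The coefficient of a monomial `μ` is read off on the points supported in the finite set of the
variables of `μ`; coefficients obtained from larger supports agree with it. -/
theorem IsLocallyPolynomial.exists_isGivenBy [Infinite k] {F : PhaseSpace n k → k} {N : ℕ}
    (hF : IsLocallyPolynomial F N) : ∃ c, IsGivenBy F c := by
  choose! p hpN hpF using hF
  have hcoeff {W W' : Set (Fin n × Exponent n)} (hW : IsAdmissible W) (hW' : IsAdmissible W')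
      (hWW' : W ⊆ W') {μ : Fin n × Exponent n →₀ ℕ} (hμ : (μ.support : Set _) ⊆ W) :
      (p W).coeff μ = (p W').coeff μ := by
    rw [← sub_eq_zero, ← MvPolynomial.coeff_sub]
    refine coeff_eq_zero_of_eval_eq_zero (fun f hf => ?_) hμ
    obtain ⟨L, rfl⟩ := exists_coord_eq fun i => (hW i).mono fun e he => hf he
    rw [map_sub, ← hpF W hW L hf, ← hpF W' hW' L (hf.trans hWW'), sub_self]
  have hterm (L : PhaseSpace n k) (μ : Fin n × Exponent n →₀ ℕ) :
      (p μ.support).coeff μ * L.coordMonomial μ =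
        (p (Function.support L.coord)).coeff μ * L.coordMonomial μ := by
    by_cases hμ : L.coordMonomial μ = 0
    · rw [hμ, mul_zero, mul_zero]
    · rw [hcoeff (isAdmissible_of_finite μ.support.finite_toSet) (isAdmissible_support_coord L)
        (coordMonomial_ne_zero.1 hμ) subset_rfl]
  refine ⟨fun μ => (p μ.support).coeff μ, ⟨N, fun μ hμ => ?_⟩, fun L => ?_, fun L => ?_⟩
  · exact (MvPolynomial.le_totalDegree (MvPolynomial.mem_support_iff.2 hμ)).trans
      (hpN _ (isAdmissible_of_finite μ.support.finite_toSet))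
  · refine (p (Function.support L.coord)).support.finite_toSet.subset fun μ hμ => ?_
    rw [Set.mem_ofPred_eq, hterm] at hμ
    exact MvPolynomial.mem_support_iff.2 (left_ne_zero_of_mul hμ)
  · rw [hpF _ (isAdmissible_support_coord L) L (subset_refl (Function.support L.coord)),
      eval_coord_eq_finsum, finsum_congr (hterm L)]

theorem mem_functionals_iff [Infinite k] {F : PhaseSpace n k → k} :
    F ∈ functionals n k ↔ ∃ N, IsLocallyPolynomial F N :=
  ⟨fun ⟨_, h⟩ => h.exists_isLocallyPolynomial, fun ⟨_, h⟩ => h.exists_isGivenBy⟩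

/-- An operator-valued function on `Pⁿ` is a polynomial map of degree at most `N` if its
coefficients are locally polynomial of degree at most `N` and its values at the points with
support in a given admissible set have support in a common well-ordered set. -/
structure IsPolynomialMap (Φ : PhaseSpace n k → PsiDO n k) (N : ℕ) : Prop where
  exists_isPWO : ∀ W, IsAdmissible W → ∃ T : Set (Exponent n), T.IsPWO ∧
    ∀ L ∈ supportedIn k W, (Φ L).support ⊆ T
  coeff : ∀ e, IsLocallyPolynomial (fun L => (Φ L).coeff e) N

theorem isPolynomialMap_one : IsPolynomialMap (fun _ : PhaseSpace n k => 1) 0 where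
  exists_isPWO _ _ := ⟨_, (1 : PsiDO n k).isPWO_support, fun _ _ => subset_rfl⟩
  coeff e _ _ := ⟨MvPolynomial.C ((1 : PsiDO n k).coeff e), (MvPolynomial.totalDegree_C _).le,
    fun L _ => (MvPolynomial.eval_C (f := L.coord) _).symm⟩

theorem isPolynomialMap_apply (i : Fin n) : IsPolynomialMap (fun L : PhaseSpace n k => L i) 1 where
  exists_isPWO _ hW := ⟨_, hW i, fun _ hL _ he => hL he⟩
  coeff e _ _ := ⟨MvPolynomial.X (i, e), (MvPolynomial.totalDegree_X _).le,
    fun L _ => (MvPolynomial.eval_X (f := L.coord) (i, e)).symm⟩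

open scoped Pointwise in
theorem IsPolynomialMap.mul {Φ Ψ : PhaseSpace n k → PsiDO n k} {N N' : ℕ}
    (hΦ : IsPolynomialMap Φ N) (hΨ : IsPolynomialMap Ψ N') :
    IsPolynomialMap (fun L => Φ L * Ψ L) (N + N') where
  exists_isPWO W hW := by
    obtain ⟨S, hS, hΦS⟩ := hΦ.exists_isPWO W hW
    obtain ⟨T, hT, hΨT⟩ := hΨ.exists_isPWO W hW
    exact ⟨_, (hS.add hT).add Exponent.isPWO_range_neg_diag, fun L hL =>
      (PsiDO.support_mul_subset _ _).trans
        (Set.add_subset_add_right (Set.add_subset_add (hΦS L hL) (hΨT L hL)))⟩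
  coeff g W hW := by
    obtain ⟨S, hS, hΦS⟩ := hΦ.exists_isPWO W hW
    obtain ⟨T, hT, hΨT⟩ := hΨ.exists_isPWO W hW
    choose p hpN hp using fun e => hΦ.coeff e W hW
    choose q hqN hq using fun e => hΨ.coeff e W hW
    have hfin := PsiDO.finite_contributions hS hT g
    refine ⟨∑ t ∈ hfin.toFinset, (leibnizCoeff t.1.d t.2.1.x t.2.2 : k) • (p t.1 * q t.2.1),
      MvPolynomial.totalDegree_finsetSum_le fun t _ => ?_, fun L hL => ?_⟩
    · exact (MvPolynomial.totalDegree_smul_le _ _).trans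
        ((MvPolynomial.totalDegree_mul _ _).trans (add_le_add (hpN _) (hqN _)))
    · simp only [map_sum, MvPolynomial.smul_eval, map_mul]
      rw [PsiDO.coeff_mul_eq_sum _ _ g (s := hfin.toFinset) fun t ht => hfin.mem_toFinset.2
        ⟨hΦS L hL ht.1, hΨT L hL ht.2.1, ht.2.2⟩]
      refine Finset.sum_congr rfl fun t ht => ?_
      rw [PsiDO.mulTerm, if_pos (hfin.mem_toFinset.1 ht).2.2, ← hp t.1 L hL, ← hq t.2.1 L hL]

theorem IsPolynomialMap.pow {Φ : PhaseSpace n k → PsiDO n k} {N : ℕ} (hΦ : IsPolynomialMap Φ N)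
    (r : ℕ) : IsPolynomialMap (fun L => Φ L ^ r) (r * N) := by
  induction r with
  | zero => simpa using isPolynomialMap_one
  | succ r ih => simpa only [pow_succ, add_mul, one_mul] using ih.mul hΦ

theorem isPolynomialMap_list_prod {α : Type*} {Φ : α → PhaseSpace n k → PsiDO n k} {N : α → ℕ}
    (hΦ : ∀ a, IsPolynomialMap (Φ a) (N a)) (l : List α) :
    IsPolynomialMap (fun L => (l.map fun a => Φ a L).prod) (l.map N).sum := by
  induction l with
  | nil => simpa using isPolynomialMap_one
  | cons a l ih => simpa only [List.map_cons, List.prod_cons, List.sum_cons] using (hΦ a).mul ih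

theorem monomial_eq_prod_map (L : PhaseSpace n k) (m : Fin n → ℕ) :
    L.monomial m = ((List.finRange n).map fun i => L i ^ m i).prod := by
  rw [monomial, List.ofFn_eq_map]

theorem hamiltonian_mem_functionals [Infinite k] (m : Fin n → ℕ) :
    hamiltonian m ∈ functionals n k := by
  refine mem_functionals_iff.2 ⟨((List.finRange n).map fun i => m i * 1).sum, ?_⟩
  have h := isPolynomialMap_list_prod (k := k) (fun i => (isPolynomialMap_apply i).pow (m i))
    (List.finRange n)
  simp only [← monomial_eq_prod_map] at h
  exact h.coeff (-Exponent.diag 1)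

theorem coeff_mem_functionals [Infinite k] (i : Fin n) (e : Exponent n) :
    (fun L : PhaseSpace n k => (L i).coeff e) ∈ functionals n k :=
  mem_functionals_iff.2 ⟨1, (isPolynomialMap_apply i).coeff e⟩

end PhaseSpace

section ChainRule

open MvPolynomial

theorem finite_support_mul_eval_pderiv {σ R : Type*} [CommRing R] (f g : σ → R)
    (p : MvPolynomial σ R) : (Function.support fun v => g v * eval f (pderiv v p)).Finite :=
  p.vars.finite_toSet.subset fun v hv => by_contra fun hvp => hv <| by
    simp only [pderiv_eq_zero_of_notMem_vars hvp, map_zero, mul_zero]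

theorem eval_aeval_line {σ R : Type*} [CommRing R] (f g : σ → R) (p : MvPolynomial σ R) (ε : R) :
    (aeval (fun v => Polynomial.C (f v) + Polynomial.C (g v) * Polynomial.X) p).eval ε =
      eval (fun v => f v + g v * ε) p := by
  induction p using MvPolynomial.induction_on with
  | C a => simp
  | add p q hp hq => simp only [map_add, Polynomial.eval_add, hp, hq]
  | mul_X p v hp => simp [hp]

theorem eval_derivative_aeval_line {σ R : Type*} [CommRing R] (f g : σ → R)
    (p : MvPolynomial σ R) :
    (aeval (fun v => Polynomial.C (f v) + Polynomial.C (g v) * Polynomial.X) p).derivative.eval 0 =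
      ∑ᶠ v, g v * eval f (pderiv v p) := by
  classical
  induction p using MvPolynomial.induction_on with
  | C a => simp
  | add p q hp hq =>
    simp only [map_add, Polynomial.eval_add, hp, hq, mul_add]
    exact (finsum_add_distrib (finite_support_mul_eval_pderiv f g p)
      (finite_support_mul_eval_pderiv f g q)).symm
  | mul_X p w hp =>
    have hX (v : σ) (hv : v ≠ w) : g v * (eval f p * eval f (pderiv v (X w))) = 0 := by
      rw [pderiv_X_of_ne hv.symm, map_zero, mul_zero, mul_zero]
    have hterm (v : σ) : g v * eval f (pderiv v (p * X w)) =
        g v * eval f (pderiv v p) * f w + g v * (eval f p * eval f (pderiv v (X w))) := by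
      rw [pderiv_mul, map_add, map_mul, map_mul, eval_X, mul_add, mul_assoc]
    have hfin := finite_support_mul_eval_pderiv f g p
    rw [finsum_congr hterm, finsum_add_distrib (hfin.subset (Function.support_mul_subset_left _ _))
      ((Set.finite_singleton w).subset fun v hv => by_contra fun hvw => hv (hX v hvw)),
      ← finsum_mul' _ _ hfin, finsum_eq_single _ w hX, ← hp]
    rw [map_mul, aeval_X, Polynomial.derivative_mul, Polynomial.eval_add, Polynomial.eval_mul,
      Polynomial.eval_mul, eval_aeval_line]
    simp
    ring

end ChainRule

namespace PhaseSpace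

variable {n : ℕ} {k : Type*} [Field k]

theorem HasDirDeriv.unique [Infinite k] {F : PhaseSpace n k → k} {L M : PhaseSpace n k} {a b : k}
    (ha : HasDirDeriv F L M a) (hb : HasDirDeriv F L M b) : a = b := by
  obtain ⟨p, hp, rfl⟩ := ha
  obtain ⟨q, hq, rfl⟩ := hb
  rw [Polynomial.funext fun ε => (hp ε).symm.trans (hq ε)]

theorem hasDirDeriv_of_eqOn_supportedIn {F : PhaseSpace n k → k} {W : Set (Fin n × Exponent n)}
    {p : MvPolynomial (Fin n × Exponent n) k} (hF : ∀ L ∈ supportedIn k W, F L = p.eval L.coord)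
    {L M : PhaseSpace n k} (hL : L ∈ supportedIn k W) (hM : M ∈ supportedIn k W) :
    HasDirDeriv F L M (∑ᶠ v, M.coord v * (p.pderiv v).eval L.coord) := by
  refine ⟨_, fun ε => ?_, eval_derivative_aeval_line L.coord M.coord p⟩
  rw [eval_aeval_line, ← coord_add_smul]
  refine hF _ fun v hv => by_contra fun hvW => hv ?_
  simp only [coord_add_smul, Function.notMem_support.1 fun h => hvW (hL h),
    Function.notMem_support.1 fun h => hvW (hM h), zero_mul, add_zero]

/-- Here `a v` is the partial derivative of `F` at `L` with respect to the coefficient `v`. -/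
theorem IsLocallyPolynomial.exists_hasDirDeriv [Infinite k] {F : PhaseSpace n k → k} {N : ℕ}
    (hF : IsLocallyPolynomial F N) (L : PhaseSpace n k) :
    ∃ a : Fin n × Exponent n → k, (∀ W, IsAdmissible W → (Function.support a ∩ W).Finite) ∧
      ∀ M, HasDirDeriv F L M (∑ᶠ v, M.coord v * a v) := by
  choose! p _ hp using hF
  have hderiv {W : Set (Fin n × Exponent n)} (hW : IsAdmissible W)
      {M : PhaseSpace n k} (hM : M ∈ supportedIn k W) : HasDirDeriv F L M
        (∑ᶠ v, M.coord v * ((p (Function.support L.coord ∪ W)).pderiv v).eval L.coord) :=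
    hasDirDeriv_of_eqOn_supportedIn (hp _ ((isAdmissible_support_coord L).union hW))
      Set.subset_union_left (hM.trans Set.subset_union_right)
  have hpartial {W : Set (Fin n × Exponent n)} (hW : IsAdmissible W) {v : Fin n × Exponent n}
      (hv : v ∈ W) : ((p (Function.support L.coord ∪ {v})).pderiv v).eval L.coord =
        ((p (Function.support L.coord ∪ W)).pderiv v).eval L.coord := by
    have hv' : IsAdmissible {v} := isAdmissible_of_finite (Set.finite_singleton v)
    obtain ⟨M, hM⟩ := exists_support_coord_eq k hv'
    have hMv : M.coord v ≠ 0 := hM.ge rfl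
    have hsum (b : Fin n × Exponent n → k) : ∑ᶠ w, M.coord w * b w = M.coord v * b v :=
      finsum_eq_single _ v fun w hw => by
        rw [Function.notMem_support.1 fun h => hw (hM.le h), zero_mul]
    have h := (hderiv hv' hM.le).unique (hderiv hW (hM.le.trans (Set.singleton_subset_iff.2 hv)))
    rw [hsum, hsum] at h
    exact mul_left_cancel₀ hMv h
  refine ⟨fun v => ((p (Function.support L.coord ∪ {v})).pderiv v).eval L.coord,
    fun W hW => ?_, fun M => ?_⟩
  · refine (p (Function.support L.coord ∪ W)).vars.finite_toSet.subset fun v hv => ?_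
    by_contra hvp
    refine hv.1 ((hpartial hW hv.2).trans ?_)
    rw [MvPolynomial.pderiv_eq_zero_of_notMem_vars hvp, map_zero]
  · have hM := isAdmissible_support_coord M
    convert hderiv hM (subset_refl (Function.support M.coord)) using 1
    refine finsum_congr fun v => ?_
    by_cases hv : M.coord v = 0
    · rw [hv, zero_mul, zero_mul]
    · exact congrArg _ (hpartial hM hv)

theorem exists_isGradient [Infinite k] {F : PhaseSpace n k → k} (hF : F ∈ functionals n k)
    (L : PhaseSpace n k) : ∃ U, IsGradient F L U := by
  obtain ⟨N, hN⟩ := mem_functionals_iff.1 hF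
  obtain ⟨a, hfin, ha⟩ := hN.exists_hasDirDeriv L
  have hrep (i : Fin n) :
      ∃ U : PsiDO n k, ∀ M : PsiDO n k, (M * U).res = ∑ᶠ e, M.coeff e * a (i, e) := by
    refine PsiDO.exists_forall_res_mul_eq fun T hT => ?_
    have hW : IsAdmissible {v : Fin n × Exponent n | v.2 ∈ T} := fun _ => hT
    exact (hfin _ hW).preimage (f := Prod.mk i) (Prod.mk_right_injective i).injOn
  choose U hU using hrep
  refine ⟨U, fun M => ?_⟩
  have hpairing : pairing M U = ∑ᶠ v, M.coord v * a v := by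
    rw [finsum_curry, finsum_eq_sum_of_fintype]
    · exact Finset.sum_congr rfl fun i _ => hU i (M i)
    · exact (hfin _ (isAdmissible_support_coord M)).subset fun v hv =>
        ⟨right_ne_zero_of_mul hv, left_ne_zero_of_mul hv⟩
  exact hpairing ▸ ha M

theorem pairing_single (M : PsiDO n k) (U : PhaseSpace n k) (i : Fin n) :
    pairing (Pi.single i M) U = (M * U i).res := by
  rw [pairing, Finset.sum_eq_single i]
  · rw [Pi.single_eq_same]
  · intro j _ hj
    rw [Pi.single_eq_of_ne hj, zero_mul, PsiDO.res_zero]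
  · exact fun hi => absurd (Finset.mem_univ i) hi

theorem IsGradient.unique [Infinite k] {F : PhaseSpace n k → k} {L U V : PhaseSpace n k}
    (hU : IsGradient F L U) (hV : IsGradient F L V) : U = V := by
  funext i
  refine PsiDO.eq_of_forall_res_mul_eq fun M => ?_
  rw [← pairing_single, ← pairing_single]
  exact (hU _).unique (hV _)

theorem existsUnique_isGradient [Infinite k] {F : PhaseSpace n k → k} (hF : F ∈ functionals n k)
    (L : PhaseSpace n k) : ∃! U, IsGradient F L U :=
  (exists_isGradient hF L).imp fun _ hU => ⟨hU, fun _ hV => hV.unique hU⟩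

theorem isGradient_gradient {F : PhaseSpace n k → k} {L : PhaseSpace n k}
    (h : ∃ U, IsGradient F L U) : IsGradient F L (gradient F L) := by
  rw [gradient, dif_pos h]
  exact h.choose_spec

end PhaseSpace

section Trace

open Polynomial

variable {ι R S : Type*} [Semiring R] [AddCommMonoid S] {τ : R →+ S}

theorem coeff_zero_pow (p : R[X]) (r : ℕ) : (p ^ r).coeff 0 = p.coeff 0 ^ r :=
  map_pow constantCoeff p r

theorem coeff_zero_list_prod_map_pow (p : ι → R[X]) (m : ι → ℕ) (l : List ι) :
    (l.map fun i => p i ^ m i).prod.coeff 0 = (l.map fun i => (p i).coeff 0 ^ m i).prod := by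
  simp only [← constantCoeff_apply, map_list_prod, List.map_map, Function.comp_def, map_pow]

theorem commute_list_prod_map_pow {a : R} {b : ι → R} (h : ∀ i, Commute a (b i))
    (m : ι → ℕ) (l : List ι) : Commute a (l.map fun i => b i ^ m i).prod :=
  Commute.list_prod_right _ _ fun _ hc => by
    obtain ⟨i, -, rfl⟩ := List.mem_map.1 hc
    exact (h i).pow_right _

theorem trace_mul_coeff_one_pow (hτ : ∀ a b, τ (a * b) = τ (b * a)) {p : R[X]} {c : R}
    (hc : Commute c (p.coeff 0)) (r : ℕ) :
    τ (c * (p ^ r).coeff 1) = r • τ (p.coeff 1 * (p.coeff 0 ^ (r - 1) * c)) := by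
  induction r generalizing c with
  | zero => simp [coeff_one]
  | succ r ih =>
    have hlast : τ (c * (p.coeff 0 ^ r * p.coeff 1)) = τ (p.coeff 1 * (p.coeff 0 ^ r * c)) := by
      rw [← mul_assoc, hτ, (hc.pow_right r).eq]
    have hinit : τ (c * ((p ^ r).coeff 1 * p.coeff 0)) =
        r • τ (p.coeff 1 * (p.coeff 0 ^ (r - 1) * (p.coeff 0 * c))) := by
      rw [← mul_assoc, hτ, ← mul_assoc, ih ((Commute.refl _).mul_left hc)]
    rw [pow_succ, mul_coeff_one, coeff_zero_pow, mul_add, map_add, hlast, hinit]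
    rcases r with _ | r
    · simp
    · rw [Nat.add_sub_cancel, Nat.add_sub_cancel, ← mul_assoc (p.coeff 0 ^ r), ← pow_succ,
        succ_nsmul' _ (r + 1)]

theorem trace_mul_coeff_one_list_prod [DecidableEq ι] (hτ : ∀ a b, τ (a * b) = τ (b * a))
    {p : ι → R[X]} (hp : ∀ i j, Commute ((p i).coeff 0) ((p j).coeff 0)) (m : ι → ℕ) {l : List ι}
    (hl : l.Nodup) {c : R} (hc : ∀ i, Commute c ((p i).coeff 0)) :
    τ (c * (l.map fun i => p i ^ m i).prod.coeff 1) =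
      (l.map fun i => m i • τ ((p i).coeff 1 *
        ((l.map fun j => (p j).coeff 0 ^ Function.update m i (m i - 1) j).prod * c))).sum := by
  induction l generalizing c with
  | nil => simp [coeff_one]
  | cons i l ih =>
    obtain ⟨hi, hl⟩ := List.nodup_cons.1 hl
    let P (m : ι → ℕ) : R := (l.map fun j => (p j).coeff 0 ^ m j).prod
    have hP (j : ι) (m : ι → ℕ) : Commute ((p j).coeff 0) (P m) :=
      commute_list_prod_map_pow (hp j) m l
    have hhead : τ (c * ((p i ^ m i).coeff 1 * P m)) =
        m i • τ ((p i).coeff 1 * ((p i).coeff 0 ^ (m i - 1) * (P m * c))) := by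
      rw [← mul_assoc, hτ, ← mul_assoc,
        trace_mul_coeff_one_pow hτ ((hP i m).symm.mul_left (hc i))]
    have htail := ih hl fun j => (hc j).mul_left ((hp i j).pow_left (m i))
    rw [List.map_cons, List.prod_cons, mul_coeff_one, coeff_zero_pow, coeff_zero_list_prod_map_pow,
      mul_add, map_add, hhead, ← mul_assoc, htail, List.map_cons, List.sum_cons, add_comm]
    congr 1
    · have hPi : P (Function.update m i (m i - 1)) = P m :=
        congrArg List.prod <| List.map_congr_left fun j hj => by
          rw [Function.update_of_ne (ne_of_mem_of_not_mem hj hi)]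
      rw [List.map_cons, List.prod_cons, Function.update_self, mul_assoc, ← hPi]
    · refine congrArg List.sum (List.map_congr_left fun j hj => ?_)
      have hcomm := ((hP i (Function.update m j (m j - 1))).mul_right (hc i).symm).pow_left (m i)
      rw [List.map_cons, List.prod_cons, Function.update_of_ne (ne_of_mem_of_not_mem hj hi).symm,
        mul_assoc, hcomm.eq, mul_assoc]

end Trace

namespace PsiDO

variable {n : ℕ} {k : Type*} [Field k]

/-- The evaluation of a polynomial with coefficients in `P` at a scalar. -/
def evalScalar (ε : k) : Polynomial (PsiDO n k) →+* PsiDO n k :=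
  Polynomial.eval₂RingHom' (RingHom.id _) (ε • 1) fun A => (Commute.one_right A).smul_right ε

theorem evalScalar_monomial (ε : k) (j : ℕ) (A : PsiDO n k) :
    evalScalar ε (Polynomial.monomial j A) = ε ^ j • A := by
  rw [evalScalar, Polynomial.eval₂RingHom'_apply, Polynomial.eval₂_monomial, RingHom.id_apply,
    smul_pow, one_pow, mul_smul_comm, mul_one]

theorem evalScalar_line (ε : k) (A B : PsiDO n k) :
    evalScalar ε (Polynomial.C A + Polynomial.C B * Polynomial.X) = A + ε • B := by
  rw [map_add, Polynomial.C_mul_X_eq_monomial, ← Polynomial.monomial_zero_left,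
    evalScalar_monomial, evalScalar_monomial, pow_zero, one_smul, pow_one]

theorem exists_eval_eq_res_evalScalar (q : Polynomial (PsiDO n k)) : ∃ p : Polynomial k,
    (∀ ε, (evalScalar ε q).res = p.eval ε) ∧ p.derivative.eval 0 = (q.coeff 1).res := by
  induction q using Polynomial.induction_on' with
  | add q r hq hr =>
    obtain ⟨p, hp, hp'⟩ := hq
    obtain ⟨s, hs, hs'⟩ := hr
    refine ⟨p + s, fun ε => ?_, ?_⟩
    · rw [map_add, Polynomial.eval_add, ← hp, ← hs, res_add]
    · rw [Polynomial.derivative_add, Polynomial.eval_add, hp', hs', Polynomial.coeff_add, res_add]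
  | monomial j A =>
    refine ⟨Polynomial.monomial j A.res, fun ε => ?_, ?_⟩
    · rw [evalScalar_monomial, res_smul, Polynomial.eval_monomial, mul_comm]
    · rw [← Polynomial.coeff_zero_eq_eval_zero, Polynomial.coeff_derivative,
        Polynomial.coeff_monomial, Polynomial.coeff_monomial]
      split_ifs <;> simp_all

end PsiDO

namespace PhaseSpace

variable {n : ℕ} {k : Type*} [Field k]

theorem isGradient_hamiltonian {L : PhaseSpace n k} (hL : L ∈ commuting n k) (m : Fin n → ℕ) :
    IsGradient (hamiltonian m) L fun i => m i • L.monomial (Function.update m i (m i - 1)) := by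
  intro M
  let line (i : Fin n) : Polynomial (PsiDO n k) :=
    Polynomial.C (L i) + Polynomial.C (M i) * Polynomial.X
  have h0 (i : Fin n) : (line i).coeff 0 = L i := by simp [line]
  have h1 (i : Fin n) : (line i).coeff 1 = M i := by simp [line]
  obtain ⟨p, hp, hp'⟩ := PsiDO.exists_eval_eq_res_evalScalar
    ((List.finRange n).map fun i => line i ^ m i).prod
  refine ⟨p, fun ε => ?_, ?_⟩
  · rw [← hp, hamiltonian, monomial_eq_prod_map, map_list_prod, List.map_map]
    congr 3
    funext i
    rw [Function.comp_apply, map_pow, PsiDO.evalScalar_line]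
    rfl
  · have hcomm (i j : Fin n) : Commute ((line i).coeff 0) ((line j).coeff 0) := by
      rw [h0, h0]
      exact commute_iff_lie_eq.2 (hL i j)
    let resHom : PsiDO n k →+ k := AddMonoidHom.mk' PsiDO.res PsiDO.res_add
    have htrace := trace_mul_coeff_one_list_prod
      (τ := resHom) PsiDO.res_mul_comm hcomm m (List.nodup_finRange n) (c := 1)
      fun _ => Commute.one_left _
    simp only [one_mul, mul_one, h0, h1, ← monomial_eq_prod_map] at htrace
    rw [hp', pairing, Fin.sum_univ_def]
    refine htrace.trans (congrArg List.sum (List.map_congr_left fun i _ => ?_))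
    rw [mul_smul_comm, ← map_nsmul]
    rfl

end PhaseSpace

namespace PsiDO

variable {n : ℕ} {k : Type*} [Field k]

theorem plus_smul (c : k) (A : PsiDO n k) : (c • A).plus = c • A.plus := by
  ext e
  simp only [plus, coeff_mk, coeff_smul, mul_ite, mul_zero]

theorem plus_nsmul (r : ℕ) (A : PsiDO n k) : (r • A).plus = r • A.plus := by
  rw [← Nat.cast_smul_eq_nsmul k, plus_smul, Nat.cast_smul_eq_nsmul]

theorem lie_rMatrix {L V : PsiDO n k} (h : Commute V L) :
    ⁅V.rMatrix, L⁆ = ⁅V.plus, L⁆ + ⁅V.plus, L⁆ := by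
  simp only [rMatrix, minus, Ring.lie_def, sub_mul, mul_sub, h.eq]
  abel

theorem res_mul_rBracket [NeZero (2 : k)] {L V : PsiDO n k} (U : PsiDO n k) (h : Commute V L) :
    (L * U.rBracket V).res = (⁅V.plus, L⁆ * U).res := by
  have hleft : (L * ⁅U.rMatrix, V⁆).res = 0 := by
    rw [res_mul_lie, commute_iff_lie_eq.1 h, mul_zero, res_zero]
  have hright : (L * ⁅U, V.rMatrix⁆).res = 2 * (⁅V.plus, L⁆ * U).res := by
    rw [res_mul_lie, lie_rMatrix h, mul_add, res_add, res_mul_comm U, two_mul]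
  rw [rBracket, mul_add, mul_smul_comm, mul_smul_comm, res_add, res_smul, res_smul, hleft, hright,
    mul_zero, zero_add, one_div, inv_mul_cancel_left₀ two_ne_zero]

end PsiDO

namespace PhaseSpace

variable {n : ℕ} {k : Type*} [Field k]

theorem commute_monomial {L : PhaseSpace n k} (hL : L ∈ commuting n k) (m : Fin n → ℕ)
    (i : Fin n) : Commute (L.monomial m) (L i) := by
  rw [monomial_eq_prod_map]
  exact (commute_list_prod_map_pow (fun j => commute_iff_lie_eq.2 (hL i j)) m _).symm

theorem poissonBracketR_hamiltonian [Infinite k] [NeZero (2 : k)] {L : PhaseSpace n k}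
    (hL : L ∈ commuting n k) (m : Fin n → ℕ) (F : PhaseSpace n k → k) :
    poissonBracketR F (hamiltonian m) L =
      pairing (fun i => m i • ⁅(L.monomial (Function.update m i (m i - 1))).plus, L i⁆)
        (gradient F L) := by
  have hH := isGradient_hamiltonian hL m
  rw [poissonBracketR, (isGradient_gradient ⟨_, hH⟩).unique hH]
  refine Finset.sum_congr rfl fun i _ => ?_
  rw [PsiDO.res_mul_rBracket _ ((commute_monomial hL _ i).smul_left (m i))]
  simp only [PsiDO.plus_nsmul, Ring.lie_def, smul_sub, smul_mul_assoc, mul_smul_comm]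

theorem hasDirDeriv_coeff (i : Fin n) (e : Exponent n) (L X : PhaseSpace n k) :
    HasDirDeriv (fun L : PhaseSpace n k => (L i).coeff e) L X ((X i).coeff e) :=
  ⟨Polynomial.C ((L i).coeff e) + Polynomial.C ((X i).coeff e) * Polynomial.X,
    fun ε => by simp [mul_comm ε], by simp⟩

theorem eq_of_forall_hasDirDeriv [Infinite k] {L X Y : PhaseSpace n k}
    {D : (PhaseSpace n k → k) → k} (hX : ∀ F ∈ functionals n k, HasDirDeriv F L X (D F))
    (hY : ∀ F ∈ functionals n k, HasDirDeriv F L Y (D F)) : X = Y := by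
  funext i
  ext e
  have hF := coeff_mem_functionals (k := k) i e
  exact ((hasDirDeriv_coeff i e L X).unique (hX _ hF)).trans
    ((hY _ hF).unique (hasDirDeriv_coeff i e L Y))

theorem isHamiltonianVelocity_hamiltonian_iff [Infinite k] [NeZero (2 : k)] {L : PhaseSpace n k}
    (hL : L ∈ commuting n k) (m : Fin n → ℕ) {X : PhaseSpace n k} :
    IsHamiltonianVelocity (hamiltonian m) L X ↔
      ∀ i, X i = m i • ⁅(L.monomial (Function.update m i (m i - 1))).plus, L i⁆ := by
  have hvelocity : IsHamiltonianVelocity (hamiltonian m) L fun i =>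
      m i • ⁅(L.monomial (Function.update m i (m i - 1))).plus, L i⁆ := fun F hF => by
    rw [poissonBracketR_hamiltonian hL]
    exact isGradient_gradient (exists_isGradient hF L) _
  rw [← funext_iff]
  exact ⟨fun hX => eq_of_forall_hasDirDeriv hX hvelocity, fun hX => hX ▸ hvelocity⟩

end PhaseSpace

end

theorem proposition8_general {k : Type*} [Field k] [Infinite k] [NeZero (2 : k)] {n : ℕ}
    (m : Fin n → ℕ) :
    PhaseSpace.hamiltonian m ∈ PhaseSpace.functionals n k ∧
    (∀ F ∈ PhaseSpace.functionals n k, ∀ L : PhaseSpace n k,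
      ∃! U : PhaseSpace n k, PhaseSpace.IsGradient F L U) ∧
    ∀ L ∈ PhaseSpace.commuting n k, ∀ X : PhaseSpace n k,
      PhaseSpace.IsHamiltonianVelocity (PhaseSpace.hamiltonian m) L X ↔
        ∀ i, X i = m i • ⁅(L.monomial (Function.update m i (m i - 1))).plus, L i⁆ :=
  ⟨PhaseSpace.hamiltonian_mem_functionals m, fun _ => PhaseSpace.existsUnique_isGradient,
    fun _ hL _ => PhaseSpace.isHamiltonianVelocity_hamiltonian_iff hL m⟩

theorem proposition8 {k : Type*} [Field k] [CharZero k] {n : ℕ} (m : Fin n → ℕ) :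
    PhaseSpace.hamiltonian m ∈ PhaseSpace.functionals n k ∧
    (∀ F ∈ PhaseSpace.functionals n k, ∀ L : PhaseSpace n k,
      ∃! U : PhaseSpace n k, PhaseSpace.IsGradient F L U) ∧
    ∀ L ∈ PhaseSpace.commuting n k, ∀ X : PhaseSpace n k,
      PhaseSpace.IsHamiltonianVelocity (PhaseSpace.hamiltonian m) L X ↔
        ∀ i, X i = m i • ⁅(L.monomial (Function.update m i (m i - 1))).plus, L i⁆ :=
  have := CharZero.infinite k
  proposition8_general m
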